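/- Let $\nu\in C^\infty(\mathbb R)$ be real-valued with $\nu(x)+\nu(1-x)=1$ for all $x$, $\nu(x)=0$ for $x\le 0$ and $\nu(x)=1$ for $x\ge 1$. Use the Fourier transform $\hat f(\xi)=\int f(x)e^{-2\pi i\langle x,\xi\rangle}\,dx$ with inverse $\check f$. Define $$W(\xi)=\begin{cases} e^{-16\pi i\xi/3}\sin\big[\tfrac{\pi}{2}\nu(16|\xi|-1)\big], & \tfrac1{16}\le|\xi|\le\tfrac18,\\ e^{-16\pi i\xi/3}\cos\big[\tfrac{\pi}{2}\nu(8|\xi|-1)\big], & \tfrac18\le|\xi|\le\tfrac14,\\ 0,&\text{else,}\end{cases}\qquad \hat\phi(\xi)=\begin{cases}1,&|\xi|\le\tfrac1{16},\\ \cos\big[\tfrac\pi2\nu(16|\xi|-1)\big],&\tfrac1{16}\le|\xi|\le\tfrac18,\\0,&\text{else,}\end{cases}$$ and, for $\xi\in\mathbb R^2$, $W^h(\xi)=W(\xi_1)\hat\phi(\xi_2)$, $W^v(\xi)=\hat\phi(\xi_1)W(\xi_2)$, $W^d(\xi)=W(\xi_1)W(\xi_2)$. The 2D Meyer Parseval wavelet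 system $\Phi=\{\psi_\lambda\}$ consists of the functions with $\hat\psi_\lambda(\xi)=2^{-j'}W^\iota(2^{-j'}\xi)e^{-2\pi i\langle k,2^{-j'}\xi\rangle}$, where $\lambda=(\iota,j',k)$ runs over $\{h,v,d\}\times\mathbb Z\times\mathbb Z^2$; write $\|\Phi^*f\|_1=\sum_\lambda|\langle f,\psi_\lambda\rangle|\in[0,\infty]$ for $f\in L^2(\mathbb R^2)$. Let $\rho>0$ and let $w:\mathbb R\to[0,1]$ be a $C^\infty$ function, not identically zero, supported in $[-\rho,\rho]$. Let $w\mathcal L$ be the distribution $\langle w\mathcal L,f\rangle=\int_{-\rho}^{\rho}w(x_1)f(x_1,0)\,dx_1$, and for $j\in\mathbb N$ put $w\mathcal L_j=w\mathcal L\star\check F_j$ with $F_j(\xi)=\sum_{\iota\in\{h,v,d\}}\big(W^\iota(2^{-2j}\xi)+W^\iota(2^{-2j-1}\xi)\big)$. Let $h_j\ge 0$ satisfy $h_j=o(2^{-2j})$ as $j\to\infty$, let $\mathcal M_{h_j}=\{x\in\mathbb R^2:|x_1|\le h_j\}$ be the missing strip, and for $A\subseteq\mathbb R^2$ let $P_A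 f=\mathbf 1_A f$. Then $w\mathcal L_j\in L^2(\mathbb R^2)$ for every $j$; for all sufficiently large $j$, $w\mathcal L_j\neq0$ and the problem $$\min\big\{\|\Phi^*L\|_1: L\in L^2(\mathbb R^2),\ P_{\mathbb R^2\setminus\mathcal M_{h_j}}L=P_{\mathbb R^2\setminus\mathcal M_{h_j}}w\mathcal L_j\big\}$$ has a solution; and if $L_j$ is a solution of this problem for all sufficiently large $j$, then $$\frac{\|L_j-w\mathcal L_j\|_2}{\|w\mathcal L_j\|_2}\to0,\qquad j\to\infty .$$ -/

import Mathlib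

open MeasureTheory Filter Topology Asymptotics
open scoped FourierTransform ContDiff ENNReal ComplexConjugate

noncomputable section

namespace MeyerInpainting

/-- The plane `ℝ²` with its Euclidean structure and Lebesgue measure. -/
abbrev Plane : Type := EuclideanSpace ℝ (Fin 2)

/-! ### The Meyer Parseval wavelet system -/

/-- The admissible auxiliary functions `ν` of the Meyer construction. -/
structure IsMeyerAux (ν : ℝ → ℝ) : Prop where
  smooth : ContDiff ℝ ∞ ν
  add_reflect : ∀ x, ν x + ν (1 - x) = 1
  eq_zero : ∀ x, x ≤ 0 → ν x = 0
  eq_one : ∀ x, 1 ≤ x → ν x = 1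

/-- The Fourier transform `W` of the one-dimensional Meyer generator. -/
def meyerW (ν : ℝ → ℝ) (ξ : ℝ) : ℂ :=
  if 1 / 16 ≤ |ξ| ∧ |ξ| ≤ 1 / 8 then
    Complex.exp (-(16 * Real.pi * Complex.I * ξ / 3)) *
      (Real.sin (Real.pi / 2 * ν (16 * |ξ| - 1)) : ℂ)
  else if 1 / 8 ≤ |ξ| ∧ |ξ| ≤ 1 / 4 then
    Complex.exp (-(16 * Real.pi * Complex.I * ξ / 3)) *
      (Real.cos (Real.pi / 2 * ν (8 * |ξ| - 1)) : ℂ)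
  else 0

/-- The Fourier transform of the (scaled) one-dimensional Meyer scaling function. -/
def meyerPhiHat (ν : ℝ → ℝ) (ξ : ℝ) : ℂ :=
  if |ξ| ≤ 1 / 16 then 1
  else if |ξ| ≤ 1 / 8 then (Real.cos (Real.pi / 2 * ν (16 * |ξ| - 1)) : ℂ)
  else 0

/-- The three wavelet types: horizontal, vertical, diagonal. -/
inductive Orient : Type
  | h | v | d

/-- The two-dimensional generators `W^h`, `W^v`, `W^d` in the Fourier domain. -/
def meyerW2 (ν : ℝ → ℝ) : Orient → Plane → ℂ
  | Orient.h, ξ => meyerW ν (ξ 0) * meyerPhiHat ν (ξ 1)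
  | Orient.v, ξ => meyerPhiHat ν (ξ 0) * meyerW ν (ξ 1)
  | Orient.d, ξ => meyerW ν (ξ 0) * meyerW ν (ξ 1)

/-- Wavelet indices `λ = (ι, j, k)` with `j ∈ ℤ` (all scales) and `k ∈ ℤ²`. -/
abbrev WaveletIndex : Type := Orient × ℤ × (ℤ × ℤ)

/-- `ψ̂_λ(ξ) = 2^{-j} W^ι(ξ / 2^j) e^{-2πi ⟨k, ξ / 2^j⟩}`. -/
def waveletHat (ν : ℝ → ℝ) (lam : WaveletIndex) (ξ : Plane) : ℂ :=
  (2 : ℂ) ^ (-lam.2.1) * meyerW2 ν lam.1 (((2 : ℝ) ^ (-lam.2.1)) • ξ) *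
    Complex.exp (-(2 * Real.pi * Complex.I *
      (((2 : ℝ) ^ (-lam.2.1) * (lam.2.2.1 * ξ 0 + lam.2.2.2 * ξ 1) : ℝ) : ℂ)))

/-- The wavelet `ψ_λ`, the inverse Fourier transform of `ψ̂_λ`. -/
def wavelet (ν : ℝ → ℝ) (lam : WaveletIndex) : Plane → ℂ :=
  𝓕⁻ (waveletHat ν lam)

/-! ### The filtered line singularity -/

/-- The distribution `wL`, i.e. the functional `f ↦ ∫_{-ρ}^{ρ} w(x₁) f(x₁, 0) dx₁`. -/
def lineSing (w : ℝ → ℝ) (ρ : ℝ) (f : Plane → ℂ) : ℂ :=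
  ∫ t in (-ρ)..ρ, (w t : ℂ) * f !₂[t, 0]

/-- Convolution of a distribution `T` with a test function: `(T ⋆ φ)(x) = T(φ(x - ·))`. -/
def distribConv (T : (Plane → ℂ) → ℂ) (φ : Plane → ℂ) (x : Plane) : ℂ :=
  T (fun y => φ (x - y))

/-- The filter `F_j = ∑_ι (W^ι(2^{-2j} ξ) + W^ι(2^{-2j-1} ξ))`, in the Fourier domain. -/
def bandFilter (ν : ℝ → ℝ) (j : ℕ) (ξ : Plane) : ℂ :=
  (meyerW2 ν Orient.h (((2 : ℝ) ^ (2 * j))⁻¹ • ξ) +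
      meyerW2 ν Orient.h (((2 : ℝ) ^ (2 * j + 1))⁻¹ • ξ)) +
    (meyerW2 ν Orient.v (((2 : ℝ) ^ (2 * j))⁻¹ • ξ) +
      meyerW2 ν Orient.v (((2 : ℝ) ^ (2 * j + 1))⁻¹ • ξ)) +
    (meyerW2 ν Orient.d (((2 : ℝ) ^ (2 * j))⁻¹ • ξ) +
      meyerW2 ν Orient.d (((2 : ℝ) ^ (2 * j + 1))⁻¹ • ξ))

/-- The filtered image `wL_j = wL ⋆ F̌_j`. -/
def filteredLine (ν w : ℝ → ℝ) (ρ : ℝ) (j : ℕ) : Plane → ℂ :=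
  distribConv (lineSing w ρ) (𝓕⁻ (bandFilter ν j))

/-! ### The mask and analysis `ℓ₁` minimization -/

/-- The missing vertical strip `{|x₁| ≤ h}`. -/
def strip (h : ℝ) : Set Plane := {x | |x 0| ≤ h}

/-- Analysis coefficient `⟨f, φ⟩ = ∫ f \bar φ` of the inner product of `L²(ℝ²)`. -/
def coeff (f φ : Plane → ℂ) : ℂ := ∫ x, f x * conj (φ x)

/-- `‖Φ^* f‖₁ ∈ [0, ∞]`. -/
def analysisL1 {I : Type} (Φ : I → Plane → ℂ) (f : Plane → ℂ) : ℝ≥0∞ :=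
  ∑' i, ‖coeff f (Φ i)‖ₑ

/-- `P_{ℝ² ∖ M} f = P_{ℝ² ∖ M} g`: the data of `f` and `g` on the known part agree. -/
def SameKnownPart (M : Set Plane) (f g : Plane → ℂ) : Prop :=
  Mᶜ.indicator f =ᵐ[volume] Mᶜ.indicator g

/-- `L ∈ argmin ‖Φ^* L‖₁` over `L ∈ L²(ℝ²)` subject to `P_{ℝ² ∖ M} L = P_{ℝ² ∖ M} x₀`. -/
structure SolvesInp {I : Type} (Φ : I → Plane → ℂ) (M : Set Plane) (x₀ L : Plane → ℂ) :
    Prop where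
  memLp : MemLp L 2 volume
  feasible : SameKnownPart M L x₀
  minimal : ∀ L' : Plane → ℂ, MemLp L' 2 volume → SameKnownPart M L' x₀ →
    analysisL1 Φ L ≤ analysisL1 Φ L'

end MeyerInpainting

end

noncomputable section

namespace MeyerInpainting

/-! ### Smoothness and supports of the Meyer generators -/

/-! For large `j` recovery is exact, which is stronger than convergence: the filtered line is itself
a minimizer, and any other minimizer agrees with it almost everywhere. The argument is a null space
property for Parseval frames.

Let `Λ` be the indices with scale between `2j - 1` and `2j + 2`. Disjointness of Fourier supports
makes all coefficients of the filtered line vanish off `Λ` (`coeff_filteredLine_eq_zero`). If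
functions `z` living in the strip `M` put at most a quarter of their coefficient `ℓ₁` mass on `Λ`,
then adding a nonzero such `z` strictly increases the `ℓ₁` norm (`tsum_enorm_add_half_le`,
`IsParsevalFrame.solvesInp_self_and_unique`).

For the quarter, replace `ψ_i` by `1_M ψ_i` in `⟨z, ψ_i⟩` and expand by the Parseval property
(`isParsevalFrame_wavelet`). This bounds `|⟨z, ψ_i⟩|` by the sum over `l` of `|⟨z, ψ_l⟩| ∫_M |ψ_i|
|ψ_l|`. Summing over `i ∈ Λ` first, the sum of `|ψ_i(x)|` is `O(2^{2j})` uniformly in `x`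
(`tsum_indicator_enorm_wavelet_le`), while `∫_M |ψ_l| = O(h_j)` uniformly over all `l`, whatever
their scale (`setLIntegral_strip_wavelet_le`). The fraction of mass on `Λ` is therefore `O(2^{2j}
h_j)`, which tends to zero by assumption. -/

lemma contDiff_comp_abs {g : ℝ → ℝ} (hg : ContDiff ℝ ∞ g) {a c : ℝ} (ha : 0 < a)
    (hc : ∀ x ≤ a, g x = c) : ContDiff ℝ ∞ fun x => g |x| := by
  rw [contDiff_iff_contDiffAt]
  intro x
  by_cases hx : x = 0
  · subst hx
    -- The corner of `|x|` at the origin is harmless because `g` is constant there.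
    have : (fun x => g |x|) =ᶠ[𝓝 0] fun _ => c := by
      filter_upwards [Metric.ball_mem_nhds (0 : ℝ) ha] with y hy
      refine hc _ ?_
      simpa [Real.norm_eq_abs] using (le_of_lt (mem_ball_zero_iff.1 hy))
    exact contDiffAt_const.congr_of_eventuallyEq this
  · exact hg.contDiffAt.comp x (contDiffAt_abs hx)

variable {ν : ℝ → ℝ}

/-- Since `ν` saturates at 0 and 1, the middle formula already gives the values of the other
branches. With the case distinction gone, smoothness can be read off; `meyerW_eq` plays the same
role. -/
lemma meyerPhiHat_eq (hν : IsMeyerAux ν) (ξ : ℝ) :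
    meyerPhiHat ν ξ = (Real.cos (Real.pi / 2 * ν (16 * |ξ| - 1)) : ℂ) := by
  unfold meyerPhiHat
  split_ifs with h1 h2
  · rw [hν.eq_zero _ (by linarith)]; simp
  · rfl
  · rw [hν.eq_one _ (by linarith)]; simp

lemma meyerW_eq (hν : IsMeyerAux ν) (ξ : ℝ) :
    meyerW ν ξ = Complex.exp (-(16 * Real.pi * Complex.I * ξ / 3)) *
      ((Real.sin (Real.pi / 2 * ν (16 * |ξ| - 1)) *
        Real.cos (Real.pi / 2 * ν (8 * |ξ| - 1)) : ℝ) : ℂ) := by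
  unfold meyerW
  split_ifs with h1 h2
  · rw [hν.eq_zero (8 * |ξ| - 1) (by linarith)]; simp
  · rw [hν.eq_one (16 * |ξ| - 1) (by linarith)]; simp
  · rcases lt_or_ge |ξ| (1 / 16) with h | h
    · rw [hν.eq_zero (16 * |ξ| - 1) (by linarith)]; simp
    · have h3 : 1 / 8 < |ξ| := by
        by_contra h4
        exact h1 ⟨h, not_lt.1 h4⟩
      have h4 : 1 / 4 < |ξ| := by
        by_contra h5
        exact h2 ⟨h3.le, not_lt.1 h5⟩
      rw [hν.eq_one (8 * |ξ| - 1) (by linarith)]; simp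

lemma contDiff_meyerPhiHat (hν : IsMeyerAux ν) : ContDiff ℝ ∞ (meyerPhiHat ν) := by
  rw [funext (meyerPhiHat_eq hν)]
  have hs := hν.smooth
  have : ContDiff ℝ ∞ fun x : ℝ => Real.cos (Real.pi / 2 * ν (16 * x - 1)) := by
    fun_prop
  exact Complex.ofRealCLM.contDiff.comp
    (contDiff_comp_abs this (a := 1 / 16) (c := 1) (by norm_num) fun x hx => by
      rw [hν.eq_zero _ (by linarith)]; simp)

lemma contDiff_meyerW (hν : IsMeyerAux ν) : ContDiff ℝ ∞ (meyerW ν) := by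
  rw [funext (meyerW_eq hν)]
  have hs := hν.smooth
  have : ContDiff ℝ ∞ fun x : ℝ => Real.sin (Real.pi / 2 * ν (16 * x - 1)) *
      Real.cos (Real.pi / 2 * ν (8 * x - 1)) := by
    fun_prop
  refine ContDiff.mul ?_ (Complex.ofRealCLM.contDiff.comp
    (contDiff_comp_abs this (a := 1 / 16) (c := 0) (by norm_num) fun x hx => by
      rw [hν.eq_zero (16 * x - 1) (by linarith)]; simp))
  have h0 : ContDiff ℝ ∞ fun x : ℝ => (x : ℂ) := Complex.ofRealCLM.contDiff
  have h1 : ContDiff ℝ ∞ fun x : ℝ => -(16 * Real.pi * Complex.I * (x : ℂ) / 3) := by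
    fun_prop
  exact h1.cexp

lemma meyerPhiHat_eq_zero (hν : IsMeyerAux ν) {ξ : ℝ} (h : 1 / 8 ≤ |ξ|) :
    meyerPhiHat ν ξ = 0 := by
  rw [meyerPhiHat_eq hν, hν.eq_one _ (by linarith)]; simp

lemma meyerPhiHat_eq_one (hν : IsMeyerAux ν) {ξ : ℝ} (h : |ξ| ≤ 1 / 16) :
    meyerPhiHat ν ξ = 1 := by
  rw [meyerPhiHat_eq hν, hν.eq_zero _ (by linarith)]; simp

lemma meyerW_eq_zero_of_le (hν : IsMeyerAux ν) {ξ : ℝ} (h : |ξ| ≤ 1 / 16) :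
    meyerW ν ξ = 0 := by
  rw [meyerW_eq hν, hν.eq_zero (16 * |ξ| - 1) (by linarith)]; simp

lemma meyerW_eq_zero_of_ge (hν : IsMeyerAux ν) {ξ : ℝ} (h : 1 / 4 ≤ |ξ|) :
    meyerW ν ξ = 0 := by
  rw [meyerW_eq hν, hν.eq_one (8 * |ξ| - 1) (by linarith)]; simp

lemma contDiff_meyerW2 (hν : IsMeyerAux ν) (ι : Orient) : ContDiff ℝ ∞ (meyerW2 ν ι) := by
  have h1 := contDiff_meyerW hν
  have h2 := contDiff_meyerPhiHat hν
  cases ι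
  · change ContDiff ℝ ∞ fun ξ : Plane => meyerW ν (ξ 0) * meyerPhiHat ν (ξ 1)
    fun_prop
  · change ContDiff ℝ ∞ fun ξ : Plane => meyerPhiHat ν (ξ 0) * meyerW ν (ξ 1)
    fun_prop
  · change ContDiff ℝ ∞ fun ξ : Plane => meyerW ν (ξ 0) * meyerW ν (ξ 1)
    fun_prop

lemma meyerW2_eq_zero_of_ge (hν : IsMeyerAux ν) (ι : Orient) {ξ : Plane} (i : Fin 2)
    (h : 1 / 4 ≤ |ξ i|) : meyerW2 ν ι ξ = 0 := by
  have h' : 1 / 8 ≤ |ξ i| := by linarith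
  fin_cases i <;> cases ι <;>
    simp_all [meyerW2, meyerW_eq_zero_of_ge hν, meyerPhiHat_eq_zero hν]

lemma meyerW2_eq_zero_of_le (hν : IsMeyerAux ν) (ι : Orient) {ξ : Plane}
    (h0 : |ξ 0| ≤ 1 / 16) (h1 : |ξ 1| ≤ 1 / 16) : meyerW2 ν ι ξ = 0 := by
  cases ι <;> simp [meyerW2, meyerW_eq_zero_of_le hν h0, meyerW_eq_zero_of_le hν h1]

lemma hasCompactSupport_of_coord {f : Plane → ℂ} {R : ℝ}
    (h : ∀ ξ : Plane, ∀ i, R ≤ |ξ i| → f ξ = 0) : HasCompactSupport f := by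
  refine HasCompactSupport.intro' (K := {ξ : Plane | ∀ i, ξ i ∈ Set.Icc (-R) R}) ?_ ?_ ?_
  · have : {ξ : Plane | ∀ i, ξ i ∈ Set.Icc (-R) R} =
        (EuclideanSpace.equiv (Fin 2) ℝ).toHomeomorph ⁻¹' (Set.univ.pi fun _ => Set.Icc (-R) R) := by
      ext ξ; simp only [Set.mem_preimage, Set.mem_pi, Set.mem_univ, true_imp_iff]; rfl
    rw [this, Homeomorph.isCompact_preimage]
    exact isCompact_univ_pi fun _ => isCompact_Icc
  · simp only [Set.ofPred_forall]
    exact isClosed_iInter fun i => isClosed_Icc.preimage (by fun_prop)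
  · intro ξ hξ
    simp only [Set.mem_ofPred_eq, not_forall, Set.mem_Icc, ← abs_le] at hξ
    obtain ⟨i, hi⟩ := hξ
    exact h ξ i (not_le.1 hi).le

lemma hasCompactSupport_meyerW2 (hν : IsMeyerAux ν) (ι : Orient) :
    HasCompactSupport (meyerW2 ν ι) :=
  hasCompactSupport_of_coord fun _ i h => meyerW2_eq_zero_of_ge hν ι i h

/-- The generator `W^ι` as a Schwartz function. -/
def generatorHat (hν : IsMeyerAux ν) (ι : Orient) : SchwartzMap Plane ℂ :=
  (hasCompactSupport_meyerW2 hν ι).toSchwartzMap (contDiff_meyerW2 hν ι)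

lemma coe_generatorHat (hν : IsMeyerAux ν) (ι : Orient) :
    (generatorHat hν ι : Plane → ℂ) = meyerW2 ν ι := rfl

lemma contDiff_waveletHat (hν : IsMeyerAux ν) (lam : WaveletIndex) :
    ContDiff ℝ ∞ (waveletHat ν lam) := by
  have h1 := contDiff_meyerW2 hν lam.1
  have h0 : ContDiff ℝ ∞ fun x : ℝ => (x : ℂ) := Complex.ofRealCLM.contDiff
  unfold waveletHat
  refine ContDiff.mul (by fun_prop) (ContDiff.cexp (ContDiff.neg (ContDiff.mul contDiff_const ?_)))
  exact h0.comp (by fun_prop)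

lemma waveletHat_eq_zero_of_ge (hν : IsMeyerAux ν) (lam : WaveletIndex) {ξ : Plane} (i : Fin 2)
    (h : (2 : ℝ) ^ lam.2.1 / 4 ≤ |ξ i|) : waveletHat ν lam ξ = 0 := by
  unfold waveletHat
  rw [meyerW2_eq_zero_of_ge hν lam.1 i, mul_zero, zero_mul]
  have : (0 : ℝ) < 2 ^ lam.2.1 := by positivity
  simp only [PiLp.smul_apply, smul_eq_mul, abs_mul, zpow_neg, abs_inv, abs_of_pos this]
  rw [le_inv_mul_iff₀ this]; linarith

lemma waveletHat_eq_zero_of_le (hν : IsMeyerAux ν) (lam : WaveletIndex) {ξ : Plane}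
    (h : ∀ i, |ξ i| ≤ (2 : ℝ) ^ lam.2.1 / 16) : waveletHat ν lam ξ = 0 := by
  unfold waveletHat
  have : (0 : ℝ) < 2 ^ lam.2.1 := by positivity
  rw [meyerW2_eq_zero_of_le hν lam.1, mul_zero, zero_mul] <;>
  · simp only [PiLp.smul_apply, smul_eq_mul, abs_mul, zpow_neg, abs_inv, abs_of_pos this]
    rw [inv_mul_le_iff₀ this]
    first | linarith [h 0] | linarith [h 1]

/-- `ψ̂_λ` as a Schwartz function. -/
def waveletHatS (hν : IsMeyerAux ν) (lam : WaveletIndex) : SchwartzMap Plane ℂ :=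
  (hasCompactSupport_of_coord fun _ i h =>
    waveletHat_eq_zero_of_ge hν lam i h).toSchwartzMap (contDiff_waveletHat hν lam)

lemma coe_waveletHatS (hν : IsMeyerAux ν) (lam : WaveletIndex) :
    (waveletHatS hν lam : Plane → ℂ) = waveletHat ν lam := rfl

/-- `ψ_λ` as a Schwartz function. -/
def waveletS (hν : IsMeyerAux ν) (lam : WaveletIndex) : SchwartzMap Plane ℂ :=
  𝓕⁻ (waveletHatS hν lam)

lemma coe_waveletS (hν : IsMeyerAux ν) (lam : WaveletIndex) :
    (waveletS hν lam : Plane → ℂ) = wavelet ν lam := by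
  rw [waveletS, SchwartzMap.fourierInv_coe, coe_waveletHatS, wavelet]

/-! ### Fourier series on a unit square -/

section Torus

open UnitAddTorus

local instance : MeasureSpace UnitAddCircle := ⟨AddCircle.haarAddCircle⟩

local instance : IsProbabilityMeasure (volume : Measure UnitAddCircle) :=
  inferInstanceAs (IsProbabilityMeasure AddCircle.haarAddCircle)

/-- The half-open unit square centred at the origin. -/
def unitSquare : Set (Fin 2 → ℝ) := {x | ∀ i, x i ∈ Set.Ioc (-(1 / 2 : ℝ)) (-(1 / 2) + 1)}

lemma measurableSet_unitSquare : MeasurableSet unitSquare :=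
  MeasurableSet.univ_pi' fun _ => measurableSet_Ioc

/-- The periodisation of the restriction of a function on the plane to the unit square. -/
def periodise (H : Plane → ℂ) (t : UnitAddTorus (Fin 2)) : ℂ :=
  H (WithLp.toLp 2 (measurableEquivPiIoc (fun _ => -(1 / 2 : ℝ)) t).1)

lemma periodise_coe (H : Plane → ℂ) {x : Fin 2 → ℝ} (hx : x ∈ unitSquare) :
    periodise H (fun i => (x i : UnitAddCircle)) = H (WithLp.toLp 2 x) := by
  have : (fun i => (x i : UnitAddCircle)) =
      (measurableEquivPiIoc (fun _ => -(1 / 2 : ℝ))).symm ⟨x, hx⟩ := rfl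
  rw [periodise, this, MeasurableEquiv.apply_symm_apply]

lemma aestronglyMeasurable_periodise {H : Plane → ℂ} (hH : AEStronglyMeasurable H volume) :
    AEStronglyMeasurable (periodise H) volume := by
  have h1 := hH.comp_measurePreserving (PiLp.volume_preserving_toLp (Fin 2))
  have h2 : Measure.QuasiMeasurePreserving (Subtype.val : unitSquare → Fin 2 → ℝ)
      (Measure.comap Subtype.val volume) volume := by
    refine ⟨measurable_subtype_coe, ?_⟩
    rw [map_comap_subtype_coe measurableSet_unitSquare]
    exact Measure.absolutelyContinuous_of_le Measure.restrict_le_self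
  exact (h1.comp_quasiMeasurePreserving h2).comp_measurePreserving
    (measurePreserving_equivPiIoc (fun _ => -(1 / 2 : ℝ)))

lemma setLIntegral_unitSquare {F : Plane → ℝ≥0∞}
    (hF : ∀ ξ : Plane, ∀ i, 1 / 2 ≤ |ξ i| → F ξ = 0) :
    ∫⁻ x in unitSquare, F (WithLp.toLp 2 x) = ∫⁻ ξ, F ξ := by
  rw [← (PiLp.volume_preserving_toLp (Fin 2)).lintegral_comp_emb
    (MeasurableEquiv.toLp 2 (Fin 2 → ℝ)).measurableEmbedding F]
  refine setLIntegral_eq_of_support_subset ?_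
  intro x hx i
  by_contra hi
  refine hx (hF _ i ?_)
  by_contra h
  have := abs_lt.1 (not_le.1 h)
  exact hi ⟨this.1, by have := this.2; simp at this; linarith⟩

lemma setIntegral_unitSquare {F : Plane → ℂ}
    (hF : ∀ ξ : Plane, ∀ i, 1 / 2 ≤ |ξ i| → F ξ = 0) :
    ∫ x in unitSquare, F (WithLp.toLp 2 x) = ∫ ξ, F ξ := by
  rw [← (PiLp.volume_preserving_toLp (Fin 2)).integral_comp
    (MeasurableEquiv.toLp 2 (Fin 2 → ℝ)).measurableEmbedding F]
  refine setIntegral_eq_integral_of_forall_compl_eq_zero ?_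
  intro x hx
  by_contra h0
  refine hx fun i => ?_
  by_contra hi
  refine h0 (hF _ i ?_)
  by_contra h
  have := abs_lt.1 (not_le.1 h)
  exact hi ⟨this.1, by have := this.2; simp at this; linarith⟩

/-- Parseval's identity for the Fourier series of a function supported in the unit square. -/
theorem tsum_enorm_sq_fourier_square {H : Plane → ℂ} (hH : MemLp H 2 volume)
    (hsupp : ∀ ξ : Plane, ∀ i, 1 / 2 ≤ |ξ i| → H ξ = 0) :
    ∑' k : ℤ × ℤ, ‖∫ ξ, H ξ * Complex.exp (2 * Real.pi * Complex.I *
      ((k.1 * ξ 0 + k.2 * ξ 1 : ℝ) : ℂ))‖ₑ ^ 2 = ∫⁻ ξ, ‖H ξ‖ₑ ^ 2 := by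
  have hint : ∫⁻ t, ‖periodise H t‖ₑ ^ 2 = ∫⁻ ξ, ‖H ξ‖ₑ ^ 2 := by
    rw [lintegral_preimage _ (fun _ => -(1 / 2 : ℝ)),
      ← setLIntegral_unitSquare (F := fun ξ => ‖H ξ‖ₑ ^ 2)
        (fun ξ i h => by simp [hsupp ξ i h])]
    refine setLIntegral_congr_fun measurableSet_unitSquare fun x hx => ?_
    simp only [periodise_coe H hx]
  have hfin : ∫⁻ ξ, ‖H ξ‖ₑ ^ 2 < ⊤ := by
    have := (eLpNorm_lt_top_iff_lintegral_rpow_enorm_lt_top (by norm_num) (by norm_num)).1 hH.2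
    simpa using this
  have hmem : MemLp (periodise H) 2 volume := by
    refine ⟨aestronglyMeasurable_periodise hH.1, ?_⟩
    refine (eLpNorm_lt_top_iff_lintegral_rpow_enorm_lt_top (by norm_num) (by norm_num)).2 ?_
    simpa [hint] using hfin
  have hcoef : ∀ n : Fin 2 → ℤ, mFourierCoeff (hmem.toLp (periodise H)) n =
      ∫ ξ, H ξ * Complex.exp (2 * Real.pi * Complex.I *
        (((-n 0 : ℤ) * ξ 0 + (-n 1 : ℤ) * ξ 1 : ℝ) : ℂ)) := by
    intro n
    have h1 : mFourierCoeff (hmem.toLp (periodise H)) n = mFourierCoeff (periodise H) n := by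
      refine integral_congr_ae ?_
      filter_upwards [hmem.coeFn_toLp] with t ht
      rw [ht]
    rw [h1, mFourierCoeff_eq_integral _ _ (fun _ => -(1 / 2 : ℝ)), ← setIntegral_unitSquare]
    · refine setIntegral_congr_fun measurableSet_unitSquare fun x hx => ?_
      simp only [periodise_coe H hx, smul_eq_mul]
      rw [mul_comm]
      congr 1
      simp only [mFourier, ContinuousMap.coe_mk, Fin.prod_univ_two, fourier_coe_apply,
        Pi.neg_apply, ← Complex.exp_add]
      congr 1
      push_cast
      ring
    · intro ξ i h
      simp [hsupp ξ i h]
  have hsum := hasSum_sq_mFourierCoeff (hmem.toLp (periodise H))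
  have hE : ∑' n : Fin 2 → ℤ, ‖mFourierCoeff (hmem.toLp (periodise H)) n‖ₑ ^ 2 =
      ∫⁻ ξ, ‖H ξ‖ₑ ^ 2 := by
    have h1 : ∀ n, ‖mFourierCoeff (hmem.toLp (periodise H)) n‖ₑ ^ 2 =
        ENNReal.ofReal (‖mFourierCoeff (hmem.toLp (periodise H)) n‖ ^ 2) := fun n => by
      rw [← ofReal_norm, ENNReal.ofReal_pow (norm_nonneg _)]
    simp_rw [h1]
    rw [← ENNReal.ofReal_tsum_of_nonneg (fun n => by positivity) hsum.summable, hsum.tsum_eq,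
      ← hint]
    rw [ofReal_integral_eq_lintegral_ofReal]
    · refine lintegral_congr_ae ?_
      filter_upwards [hmem.coeFn_toLp] with t ht
      rw [ht, ENNReal.ofReal_pow (norm_nonneg _), ofReal_norm]
    · exact (Lp.memLp (hmem.toLp (periodise H))).integrable_norm_pow (by norm_num)
    · exact ae_of_all _ fun t => by positivity
  -- Torus coefficients integrate against `e^{-2πi⟨n, ξ⟩}`, while the claim has the opposite sign;
  -- hence the reindexing by negation.
  rw [← hE, ← ((finTwoArrowEquiv ℤ).symm.trans (Equiv.neg _)).tsum_eq]
  refine tsum_congr fun k => ?_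
  rw [hcoef]
  simp [finTwoArrowEquiv]

end Torus

/-! ### The Parseval frame property -/

instance : Fintype Orient :=
  ⟨⟨[Orient.h, Orient.v, Orient.d], by simp⟩, by rintro ⟨⟩ <;> simp⟩

lemma sum_orient {M : Type*} [AddCommMonoid M] (f : Orient → M) :
    ∑ ι, f ι = f Orient.h + (f Orient.v + f Orient.d) := by
  change (Multiset.map f ↑[Orient.h, Orient.v, Orient.d]).sum = _
  simp

/-- At most one of the two `ν` factors varies on each side of `|ξ| = 1/8`, so this is `sin² + cos² =
1`. The difference form is what telescopes over scales. -/
lemma norm_sq_meyerW (hν : IsMeyerAux ν) (ξ : ℝ) :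
    ‖meyerW ν ξ‖ ^ 2 = ‖meyerPhiHat ν (2⁻¹ * ξ)‖ ^ 2 - ‖meyerPhiHat ν ξ‖ ^ 2 := by
  have hexp : ‖Complex.exp (-(16 * Real.pi * Complex.I * ξ / 3))‖ = 1 := by
    have : -(16 * Real.pi * Complex.I * ξ / 3) = ((-(16 * Real.pi * ξ / 3) : ℝ) : ℂ) * Complex.I := by
      push_cast; ring
    rw [this, Complex.norm_exp_ofReal_mul_I]
  have h8 : 16 * |2⁻¹ * ξ| - 1 = 8 * |ξ| - 1 := by
    rw [abs_mul, abs_of_pos (by norm_num : (0 : ℝ) < 2⁻¹)]; ring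
  rw [meyerW_eq hν, meyerPhiHat_eq hν, meyerPhiHat_eq hν, norm_mul, hexp, h8]
  simp only [Complex.norm_real, Real.norm_eq_abs, one_mul, sq_abs]
  rcases le_total |ξ| (1 / 8) with h | h
  · rw [hν.eq_zero (8 * |ξ| - 1) (by linarith)]
    simp only [mul_zero, Real.cos_zero, mul_one]
    linarith [Real.sin_sq_add_cos_sq (Real.pi / 2 * ν (16 * |ξ| - 1))]
  · rw [hν.eq_one (16 * |ξ| - 1) (by linarith)]
    simp

/-- The squared modulus of the two-dimensional scaling function, in the Fourier domain. -/
def scalingSq (ν : ℝ → ℝ) (ξ : Plane) : ℝ := ‖meyerPhiHat ν (ξ 0)‖ ^ 2 * ‖meyerPhiHat ν (ξ 1)‖ ^ 2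

/-- With `a_i`, `b_i` the squared moduli of the scaling function at `ξ_i` and `ξ_i/2`, this is
`(b₀-a₀)a₁ + a₀(b₁-a₁) + (b₀-a₀)(b₁-a₁) = b₀b₁ - a₀a₁`. -/
lemma sum_norm_sq_meyerW2 (hν : IsMeyerAux ν) (ξ : Plane) :
    ∑ ι, ‖meyerW2 ν ι ξ‖ ^ 2 = scalingSq ν ((2⁻¹ : ℝ) • ξ) - scalingSq ν ξ := by
  rw [sum_orient]
  simp only [meyerW2, norm_mul, mul_pow, norm_sq_meyerW hν, scalingSq, PiLp.smul_apply, smul_eq_mul]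
  ring

lemma scalingSq_eventually_one (hν : IsMeyerAux ν) (ξ : Plane) :
    ∀ᶠ n : ℕ in atTop, scalingSq ν (((2 : ℝ) ^ (-(n : ℤ))) • ξ) = 1 := by
  have key : ∀ i, ∀ᶠ n : ℕ in atTop, |((2 : ℝ) ^ (-(n : ℤ)) • ξ) i| ≤ 1 / 16 := fun i => by
    have : Tendsto (fun n : ℕ => |(1 / 2 : ℝ) ^ n * ξ i|) atTop (𝓝 |0 * ξ i|) :=
      ((tendsto_pow_atTop_nhds_zero_of_lt_one (by norm_num) (by norm_num)).mul_const _).abs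
    simp only [zero_mul, abs_zero] at this
    filter_upwards [this.eventually_le_const (by norm_num : (0 : ℝ) < 1 / 16)] with n hn
    simpa using hn
  filter_upwards [key 0, key 1] with n h0 h1
  rw [scalingSq, meyerPhiHat_eq_one hν h0, meyerPhiHat_eq_one hν h1]
  simp

lemma scalingSq_eventually_zero (hν : IsMeyerAux ν) {ξ : Plane} (hξ : ξ ≠ 0) :
    ∀ᶠ n : ℕ in atTop, scalingSq ν (((2 : ℝ) ^ n) • ξ) = 0 := by
  obtain ⟨i, hi⟩ : ∃ i, ξ i ≠ 0 := by
    by_contra! h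
    exact hξ (by ext i; simpa using h i)
  have : Tendsto (fun n : ℕ => (2 : ℝ) ^ n * |ξ i|) atTop atTop :=
    (tendsto_pow_atTop_atTop_of_one_lt (by norm_num)).atTop_mul_const (abs_pos.2 hi)
  filter_upwards [this.eventually_ge_atTop (1 / 8)] with n hn
  have h' : 1 / 8 ≤ |((2 : ℝ) ^ n • ξ) i| := by
    simpa [abs_mul] using hn
  have := meyerPhiHat_eq_zero hν h'
  fin_cases i <;> simp_all [scalingSq]

/-- A two-sided telescoping sum, split at 0. Nonnegativity upgrades convergence of partial sums to
unconditional summability. -/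
lemma hasSum_int_sub_of_eventually {B : ℤ → ℝ} (hnn : ∀ j, 0 ≤ B (j + 1) - B j)
    (hone : ∀ᶠ n : ℕ in atTop, B n = 1) (hzero : ∀ᶠ n : ℕ in atTop, B (-(n : ℤ)) = 0) :
    HasSum (fun j : ℤ => B (j + 1) - B j) 1 := by
  have h1 : HasSum (fun n : ℕ => B ((n : ℤ) + 1) - B n) (1 - B 0) := by
    rw [hasSum_iff_tendsto_nat_of_nonneg fun i => hnn i]
    have : ∀ n : ℕ, ∑ i ∈ Finset.range n, (B ((i : ℤ) + 1) - B i) = B n - B 0 := fun n => by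
      have := Finset.sum_range_sub (fun n : ℕ => B n) n
      simpa using this
    simp_rw [this]
    exact (tendsto_const_nhds.congr' (hone.mono fun n hn => hn.symm)).sub_const _
  have h2 : HasSum (fun n : ℕ => B (-((n : ℤ) + 1) + 1) - B (-((n : ℤ) + 1))) (B 0) := by
    rw [hasSum_iff_tendsto_nat_of_nonneg fun i => hnn _]
    have : ∀ n : ℕ, ∑ i ∈ Finset.range n, (B (-((i : ℤ) + 1) + 1) - B (-((i : ℤ) + 1))) =
        B 0 - B (-(n : ℤ)) := fun n => by
      have := Finset.sum_range_sub' (fun n : ℕ => B (-(n : ℤ))) n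
      simpa using this
    simp_rw [this]
    have : Tendsto (fun n : ℕ => B 0 - B (-(n : ℤ))) atTop (𝓝 (B 0 - 0)) :=
      (tendsto_const_nhds.congr' (hzero.mono fun n hn => hn.symm)).const_sub _
    rwa [sub_zero] at this
  have h3 := HasSum.of_nat_of_neg_add_one (f := fun j : ℤ => B (j + 1) - B j) h1 h2
  rwa [sub_add_cancel] at h3

/-- The dilates of the three generators form a partition of unity. -/
lemma tsum_enorm_sq_meyerW2 (hν : IsMeyerAux ν) {ξ : Plane} (hξ : ξ ≠ 0) :
    ∑' p : Orient × ℤ, ‖meyerW2 ν p.1 (((2 : ℝ) ^ (-p.2)) • ξ)‖ₑ ^ 2 = 1 := by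
  set B : ℤ → ℝ := fun j => scalingSq ν (((2 : ℝ) ^ (-j)) • ξ) with hB
  have hstep : ∀ j : ℤ, ∑ ι, ‖meyerW2 ν ι (((2 : ℝ) ^ (-j)) • ξ)‖ ^ 2 = B (j + 1) - B j := fun j => by
    rw [sum_norm_sq_meyerW2 hν, smul_smul, hB]
    congr 3
    rw [neg_add, zpow_add₀ two_ne_zero, mul_comm]; simp
  have hnn : ∀ j, 0 ≤ B (j + 1) - B j := fun j => by
    rw [← hstep]; positivity
  have h3 : HasSum (fun j : ℤ => B (j + 1) - B j) 1 :=
    hasSum_int_sub_of_eventually hnn (scalingSq_eventually_one hν ξ)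
      ((scalingSq_eventually_zero hν hξ).mono fun n hn => by simpa [hB] using hn)
  rw [ENNReal.tsum_prod', ENNReal.tsum_comm]
  have h4 : ∀ j : ℤ, ∑' ι, ‖meyerW2 ν ι (((2 : ℝ) ^ (-j)) • ξ)‖ₑ ^ 2 =
      ENNReal.ofReal (B (j + 1) - B j) := fun j => by
    rw [← hstep, tsum_fintype, ENNReal.ofReal_sum_of_nonneg fun _ _ => by positivity]
    refine Finset.sum_congr rfl fun ι _ => ?_
    rw [ENNReal.ofReal_pow (norm_nonneg _), ofReal_norm]
  simp_rw [h4]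
  rw [← ENNReal.ofReal_tsum_of_nonneg hnn h3.summable, h3.tsum_eq, ENNReal.ofReal_one]

lemma lintegral_comp_smul_of_pos {E : Type*} [NormedAddCommGroup E] [NormedSpace ℝ E]
    [MeasurableSpace E] [BorelSpace E] [FiniteDimensional ℝ E] (μ : Measure E) [μ.IsAddHaarMeasure]
    (f : E → ℝ≥0∞) {R : ℝ} (hR : 0 < R) :
    ENNReal.ofReal (R ^ Module.finrank ℝ E) * ∫⁻ x, f (R • x) ∂μ = ∫⁻ x, f x ∂μ := by
  have h1 : ∫⁻ x, f (R • x) ∂μ = ∫⁻ y, f y ∂(Measure.map (fun x : E => R • x) μ) :=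
    (lintegral_map_equiv f
      (Homeomorph.smul (isUnit_iff_ne_zero.2 hR.ne').unit).toMeasurableEquiv).symm
  rw [h1, Measure.map_addHaar_smul _ hR.ne', lintegral_smul_measure, smul_eq_mul, ← mul_assoc,
    ← ENNReal.ofReal_mul (by positivity), abs_of_pos (by positivity),
    mul_inv_cancel₀ (by positivity), ENNReal.ofReal_one, one_mul]

lemma integral_comp_smul_plane (f : Plane → ℂ) {R : ℝ} (hR : 0 < R) :
    ∫ x, f x = ((R : ℂ) ^ 2) * ∫ x, f (R • x) := by
  rw [Measure.integral_comp_smul, finrank_euclideanSpace_fin, abs_of_pos (by positivity),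
    Complex.real_smul, ← mul_assoc]
  push_cast
  rw [mul_inv_cancel₀ (by exact_mod_cast (pow_pos hR 2).ne'), one_mul]

/-- The energy of the coefficients at a fixed orientation and scale. -/
lemma tsum_enorm_sq_waveletHat (hν : IsMeyerAux ν) {G : Plane → ℂ} (hG : MemLp G 2 volume)
    (ι : Orient) (j : ℤ) :
    ∑' k : ℤ × ℤ, ‖∫ ξ, G ξ * conj (waveletHat ν (ι, j, k) ξ)‖ₑ ^ 2 =
      ∫⁻ ξ, ‖G ξ‖ₑ ^ 2 * ‖meyerW2 ν ι (((2 : ℝ) ^ (-j)) • ξ)‖ₑ ^ 2 := by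
  set R : ℝ := 2 ^ j with hR
  have hRpos : 0 < R := by positivity
  have hRinv : (2 : ℝ) ^ (-j) = R⁻¹ := by rw [zpow_neg]
  -- Substituting `ξ = R η` gives the Jacobian `R²`, of which the wavelet normalization `R⁻¹` leaves
  -- `R`. The function `H` vanishes for `|η_i| ≥ 1/4`, so its coefficients against integer
  -- characters are genuine Fourier coefficients on the unit square.
  set H : Plane → ℂ := fun η => R * (G (R • η) * conj (meyerW2 ν ι η)) with hH
  have hlint : ∫⁻ η, ‖H η‖ₑ ^ 2 =
      ∫⁻ ξ, ‖G ξ‖ₑ ^ 2 * ‖meyerW2 ν ι (((2 : ℝ) ^ (-j)) • ξ)‖ₑ ^ 2 := by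
    rw [← lintegral_comp_smul_of_pos volume
      (fun ξ => ‖G ξ‖ₑ ^ 2 * ‖meyerW2 ν ι (((2 : ℝ) ^ (-j)) • ξ)‖ₑ ^ 2) hRpos,
      finrank_euclideanSpace_fin,
      ← lintegral_const_mul' _ _ ENNReal.ofReal_ne_top]
    refine lintegral_congr fun η => ?_
    rw [hRinv, smul_smul, inv_mul_cancel₀ hRpos.ne', one_smul, hH]
    simp only [enorm_mul, mul_pow, RCLike.enorm_conj]
    rw [ENNReal.ofReal_pow hRpos.le]
    congr 2
    rw [← ofReal_norm, Complex.norm_real, Real.norm_of_nonneg hRpos.le]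
  have hbound : ∃ C : ℝ, ∀ ξ, ‖meyerW2 ν ι ξ‖ ≤ C :=
    (hasCompactSupport_meyerW2 hν ι).exists_bound_of_continuous (contDiff_meyerW2 hν ι).continuous
  obtain ⟨C, hC⟩ := hbound
  have hmem : MemLp H 2 volume := by
    have hm : AEStronglyMeasurable H volume := by
      refine AEStronglyMeasurable.const_mul (AEStronglyMeasurable.mul ?_ ?_) _
      · exact hG.1.comp_quasiMeasurePreserving (Measure.quasiMeasurePreserving_smul _ hRpos.ne')
      · exact ((contDiff_meyerW2 hν ι).continuous.star).aestronglyMeasurable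
    refine ⟨hm, ?_⟩
    refine (eLpNorm_lt_top_iff_lintegral_rpow_enorm_lt_top (by norm_num) (by norm_num)).2 ?_
    simp only [ENNReal.toReal_ofNat, ENNReal.rpow_ofNat]
    rw [hlint]
    have hfin : ∫⁻ ξ, ‖G ξ‖ₑ ^ 2 < ⊤ := by
      have := (eLpNorm_lt_top_iff_lintegral_rpow_enorm_lt_top (by norm_num) (by norm_num)).1 hG.2
      simpa using this
    calc _ ≤ ∫⁻ ξ, ‖G ξ‖ₑ ^ 2 * ENNReal.ofReal C ^ 2 := by
          refine lintegral_mono fun ξ => ?_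
          gcongr
          rw [← ofReal_norm]
          exact ENNReal.ofReal_le_ofReal (hC _)
      _ = (∫⁻ ξ, ‖G ξ‖ₑ ^ 2) * ENNReal.ofReal C ^ 2 :=
          lintegral_mul_const' _ _ (ENNReal.pow_ne_top ENNReal.ofReal_ne_top)
      _ < ⊤ := ENNReal.mul_lt_top hfin (ENNReal.pow_lt_top ENNReal.ofReal_lt_top)
  rw [← hlint, ← tsum_enorm_sq_fourier_square hmem]
  · refine tsum_congr fun k => ?_
    congr 2
    rw [integral_comp_smul_plane _ hRpos, ← integral_const_mul]
    refine integral_congr_ae (ae_of_all _ fun η => ?_)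
    have hexp : conj (Complex.exp (-(2 * Real.pi * Complex.I *
        ((R⁻¹ * (k.1 * (R • η) 0 + k.2 * (R • η) 1) : ℝ) : ℂ)))) =
        Complex.exp (2 * Real.pi * Complex.I * ((k.1 * η 0 + k.2 * η 1 : ℝ) : ℂ)) := by
      rw [← Complex.exp_conj]
      congr 1
      have : R⁻¹ * (k.1 * (R • η) 0 + k.2 * (R • η) 1) = k.1 * η 0 + k.2 * η 1 := by
        simp only [PiLp.smul_apply, smul_eq_mul]; field_simp
      rw [this]
      simp only [map_neg, map_mul, Complex.conj_I, Complex.conj_ofReal, map_ofNat]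
      ring
    simp only [waveletHat, hRinv, map_mul, hexp, smul_smul, inv_mul_cancel₀ hRpos.ne', one_smul, hH]
    have : conj ((2 : ℂ) ^ (-j)) = (R : ℂ)⁻¹ := by
      rw [hR, map_zpow₀, map_ofNat, zpow_neg]; push_cast; rfl
    rw [this]
    have : (R : ℂ) ≠ 0 := by exact_mod_cast hRpos.ne'
    field_simp
  · intro ξ i h
    simp [hH, meyerW2_eq_zero_of_ge hν ι i (by linarith : 1 / 4 ≤ |ξ i|)]

lemma inner_toLp_schwartz (f : SchwartzMap Plane ℂ) (g : Lp ℂ 2 (volume : Measure Plane)) :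
    inner ℂ (f.toLp 2) g = ∫ x, g x * conj (f x) := by
  rw [L2.inner_def]
  refine integral_congr_ae ?_
  filter_upwards [f.coeFn_toLp 2 volume] with x hx
  simp [hx]

lemma tsum_waveletIndex (f : WaveletIndex → ℝ≥0∞) :
    ∑' lam, f lam = ∑' p : Orient × ℤ, ∑' k, f (p.1, p.2, k) := by
  rw [← (Equiv.prodAssoc Orient ℤ (ℤ × ℤ)).tsum_eq, ENNReal.tsum_prod']
  rfl

/-- The Meyer wavelets form a Parseval frame of `L²(ℝ²)`. -/
theorem tsum_enorm_sq_inner_wavelet (hν : IsMeyerAux ν) (z : Lp ℂ 2 (volume : Measure Plane)) :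
    ∑' lam, ‖inner ℂ ((waveletS hν lam).toLp 2) z‖ₑ ^ 2 = ‖z‖ₑ ^ 2 := by
  set G := 𝓕 z with hGdef
  -- Plancherel moves the coefficients to the Fourier side, where each scale and orientation is a
  -- Fourier series.
  have hz : ∀ lam, inner ℂ ((waveletS hν lam).toLp 2) z =
      ∫ ξ, G ξ * conj (waveletHat ν lam ξ) := fun lam => by
    rw [← Lp.inner_fourier_eq, SchwartzMap.toLp_fourier_eq, waveletS,
      FourierTransform.fourier_fourierInv_eq, inner_toLp_schwartz]
    rfl
  have hnorm : ‖z‖ₑ ^ 2 = ∫⁻ ξ, ‖G ξ‖ₑ ^ 2 := by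
    have : ‖z‖ₑ = ‖G‖ₑ := by
      rw [← ofReal_norm, ← ofReal_norm, hGdef, Lp.norm_fourier_eq]
    rw [this, Lp.enorm_def, eLpNorm_eq_lintegral_rpow_enorm_toReal (by norm_num) (by norm_num)]
    simp only [ENNReal.toReal_ofNat, ENNReal.rpow_ofNat]
    rw [← ENNReal.rpow_natCast, ← ENNReal.rpow_mul]
    simp
  simp_rw [hz]
  rw [tsum_waveletIndex]
  simp_rw [tsum_enorm_sq_waveletHat hν (Lp.memLp G)]
  have hm : AEMeasurable (fun ξ => ‖G ξ‖ₑ ^ 2) volume :=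
    ((Lp.aestronglyMeasurable G).enorm).pow_const 2
  rw [← lintegral_tsum, hnorm]
  · refine lintegral_congr_ae ?_
    -- The origin is the only frequency missed by the partition of unity, and it is a null set.
    have : ∀ᵐ ξ : Plane, ξ ≠ 0 := by simp [ae_iff]
    filter_upwards [this] with ξ hξ
    rw [ENNReal.tsum_mul_left, tsum_enorm_sq_meyerW2 hν hξ, mul_one]
  · intro p
    refine hm.mul ?_
    have : Continuous fun ξ : Plane => meyerW2 ν p.1 (((2 : ℝ) ^ (-p.2)) • ξ) :=
      (contDiff_meyerW2 hν p.1).continuous.comp (by fun_prop)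
    exact ((this.enorm).measurable.pow_const 2).aemeasurable

/-! ### Decay of the wavelets -/

/-- The bound is a product so that later sums over `k` and integrals over the strip separate by
coordinate. The fourth power of `1 + ‖x‖` dominates both quadratic factors. -/
lemma schwartz_decay (f : SchwartzMap Plane ℂ) :
    ∃ C : ℝ, 0 ≤ C ∧ ∀ x : Plane, ‖f x‖ ≤ C * ((1 + x 0 ^ 2)⁻¹ * (1 + x 1 ^ 2)⁻¹) := by
  refine ⟨2 ^ 4 * ((Finset.Iic (4, 0)).sup fun m => SchwartzMap.seminorm ℝ m.1 m.2) f,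
    by positivity, fun x => ?_⟩
  have h := SchwartzMap.one_add_le_sup_seminorm_apply (𝕜 := ℝ) (m := (4, 0)) (k := 4) (n := 0)
    le_rfl le_rfl f x
  rw [norm_iteratedFDeriv_zero] at h
  have hx : ‖x‖ ^ 2 = x 0 ^ 2 + x 1 ^ 2 := by
    rw [EuclideanSpace.norm_sq_eq]; simp [Fin.sum_univ_two]
  have h1 : (1 + x 0 ^ 2) * (1 + x 1 ^ 2) ≤ (1 + ‖x‖) ^ 4 := by
    have h2 : 1 + ‖x‖ ^ 2 ≤ (1 + ‖x‖) ^ 2 := by nlinarith [norm_nonneg x]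
    calc (1 + x 0 ^ 2) * (1 + x 1 ^ 2) ≤ (1 + ‖x‖ ^ 2) * (1 + ‖x‖ ^ 2) := by
          rw [hx]
          nlinarith [sq_nonneg (x 0), sq_nonneg (x 1), sq_nonneg (x 0 ^ 2), sq_nonneg (x 1 ^ 2),
            mul_nonneg (sq_nonneg (x 0)) (sq_nonneg (x 1))]
      _ ≤ (1 + ‖x‖) ^ 2 * (1 + ‖x‖) ^ 2 := by gcongr
      _ = _ := by ring
  rw [← mul_inv, ← div_eq_mul_inv, le_div_iff₀ (by positivity), mul_comm]
  exact (mul_le_mul_of_nonneg_right h1 (norm_nonneg _)).trans h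

/-- The wavelets are dyadic dilates and translates of the three generators. -/
lemma wavelet_eq (lam : WaveletIndex) (x : Plane) :
    wavelet ν lam x = (2 : ℂ) ^ lam.2.1 *
      𝓕⁻ (meyerW2 ν lam.1) ((2 : ℝ) ^ lam.2.1 • x - !₂[(lam.2.2.1 : ℝ), (lam.2.2.2 : ℝ)]) := by
  set R : ℝ := 2 ^ lam.2.1 with hR
  have hRpos : 0 < R := by positivity
  have hRinv : (2 : ℝ) ^ (-lam.2.1) = R⁻¹ := by rw [zpow_neg]
  have hRc : (2 : ℂ) ^ lam.2.1 = R := by rw [hR]; push_cast; rfl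
  have hR0 : (R : ℂ) ≠ 0 := by exact_mod_cast hRpos.ne'
  rw [wavelet, Real.fourierInv_eq', Real.fourierInv_eq', integral_comp_smul_plane _ hRpos,
    ← integral_const_mul, ← integral_const_mul]
  refine integral_congr_ae (ae_of_all _ fun η => ?_)
  simp only [waveletHat, hRinv, zpow_neg, hRc, smul_smul, inv_mul_cancel₀ hRpos.ne', one_smul,
    smul_eq_mul]
  have hexp : Complex.exp (((2 * Real.pi * inner ℝ (R • η) x : ℝ) : ℂ) * Complex.I) *
      Complex.exp (-(2 * Real.pi * Complex.I *
        ((R⁻¹ * (lam.2.2.1 * (R • η) 0 + lam.2.2.2 * (R • η) 1) : ℝ) : ℂ))) =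
      Complex.exp (((2 * Real.pi * inner ℝ η
        (R • x - !₂[(lam.2.2.1 : ℝ), (lam.2.2.2 : ℝ)]) : ℝ) : ℂ) * Complex.I) := by
    rw [← Complex.exp_add]
    congr 1
    simp only [PiLp.inner_apply, Fin.sum_univ_two, PiLp.smul_apply, PiLp.sub_apply, smul_eq_mul,
      RCLike.inner_apply, conj_trivial]
    push_cast
    field_simp
    ring
  rw [← hexp]
  field_simp

lemma wavelet_decay (hν : IsMeyerAux ν) : ∃ C : ℝ, 0 ≤ C ∧ ∀ (lam : WaveletIndex) (x : Plane),
    ‖wavelet ν lam x‖ ≤ C * 2 ^ lam.2.1 * ((1 + (2 ^ lam.2.1 * x 0 - lam.2.2.1) ^ 2)⁻¹ *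
      (1 + (2 ^ lam.2.1 * x 1 - lam.2.2.2) ^ 2)⁻¹) := by
  choose C hC0 hC using fun ι => schwartz_decay (𝓕⁻ (generatorHat hν ι))
  refine ⟨∑ ι, C ι, Finset.sum_nonneg fun ι _ => hC0 ι, fun lam x => ?_⟩
  rw [wavelet_eq, norm_mul, norm_zpow, mul_comm (∑ ι, C ι), mul_assoc]
  simp only [Complex.norm_ofNat]
  gcongr
  have h1 := hC lam.1 ((2 : ℝ) ^ lam.2.1 • x - !₂[(lam.2.2.1 : ℝ), (lam.2.2.2 : ℝ)])
  rw [SchwartzMap.fourierInv_coe, coe_generatorHat] at h1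
  refine h1.trans ?_
  have h2 : C lam.1 ≤ ∑ ι, C ι :=
    Finset.single_le_sum (fun ι _ => hC0 ι) (Finset.mem_univ lam.1)
  simp only [PiLp.sub_apply, PiLp.smul_apply, smul_eq_mul]
  exact mul_le_mul_of_nonneg_right h2 (by positivity)

lemma tsum_inv_one_add_sq_bound : ∃ D : ℝ≥0∞, D ≠ ⊤ ∧ ∀ t : ℝ,
    ∑' k : ℤ, ENNReal.ofReal ((1 + (t - k) ^ 2)⁻¹) ≤ D := by
  have hs : Summable fun k : ℤ => (1 + (k : ℝ) ^ 2)⁻¹ := by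
    have h1 : Summable fun k : ℤ => 1 / (k : ℝ) ^ 2 + if k = 0 then 1 else 0 :=
      (Real.summable_one_div_int_pow.2 (by norm_num)).add (hasSum_ite_eq 0 1).summable
    refine h1.of_nonneg_of_le (fun k => by positivity) fun k => ?_
    by_cases hk : k = 0
    · simp [hk]
    · have : (0 : ℝ) < (k : ℝ) ^ 2 := by positivity
      rw [if_neg hk, add_zero, one_div]
      gcongr
      linarith
  -- Shifting `k` by `⌊t⌋` replaces `t` by its fractional part `s`. Then `k² ≤ 2(s-k)² + 2s²` and `s
  -- < 1` give `1 + k² ≤ 3(1 + (s-k)²)`.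
  refine ⟨ENNReal.ofReal 3 * ∑' k : ℤ, ENNReal.ofReal ((1 + (k : ℝ) ^ 2)⁻¹), ?_, fun t => ?_⟩
  · refine ENNReal.mul_ne_top ENNReal.ofReal_ne_top ?_
    rw [← ENNReal.ofReal_tsum_of_nonneg (fun k => by positivity) hs]
    exact ENNReal.ofReal_ne_top
  · rw [← (Equiv.addRight ⌊t⌋).tsum_eq, ← ENNReal.tsum_mul_left]
    refine ENNReal.tsum_le_tsum fun k => ?_
    rw [← ENNReal.ofReal_mul (by norm_num)]
    refine ENNReal.ofReal_le_ofReal ?_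
    simp only [Equiv.coe_addRight]
    rw [← div_eq_mul_inv, le_div_iff₀ (by positivity), inv_mul_le_iff₀ (by positivity)]
    push_cast
    have h0 := Int.floor_le t
    have h1 := Int.lt_floor_add_one t
    set s := t - ⌊t⌋ with hs
    have : t - (k + ⌊t⌋) = s - k := by rw [hs]; ring
    rw [this]
    nlinarith [sq_nonneg (2 * s - k), sq_nonneg (s - k), sq_nonneg ((k : ℝ) - 2 * s)]

/-- Uniform bound for the wavelets of a fixed orientation and scale. -/
lemma tsum_enorm_wavelet_le (hν : IsMeyerAux ν) : ∃ C : ℝ≥0∞, C ≠ ⊤ ∧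
    ∀ (ι : Orient) (j : ℤ) (x : Plane),
      ∑' k : ℤ × ℤ, ‖wavelet ν (ι, j, k) x‖ₑ ≤ C * ENNReal.ofReal (2 ^ j) := by
  obtain ⟨C, hC0, hC⟩ := wavelet_decay hν
  obtain ⟨D, hD, hDb⟩ := tsum_inv_one_add_sq_bound
  refine ⟨ENNReal.ofReal C * (D * D), ENNReal.mul_ne_top ENNReal.ofReal_ne_top
    (ENNReal.mul_ne_top hD hD), fun ι j x => ?_⟩
  calc ∑' k : ℤ × ℤ, ‖wavelet ν (ι, j, k) x‖ₑ
      ≤ ∑' k : ℤ × ℤ, ENNReal.ofReal (C * 2 ^ j) *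
        (ENNReal.ofReal ((1 + (2 ^ j * x 0 - k.1) ^ 2)⁻¹) *
          ENNReal.ofReal ((1 + (2 ^ j * x 1 - k.2) ^ 2)⁻¹)) := by
        refine ENNReal.tsum_le_tsum fun k => ?_
        rw [← ENNReal.ofReal_mul (by positivity), ← ENNReal.ofReal_mul (by positivity),
          ← ofReal_norm]
        exact ENNReal.ofReal_le_ofReal (hC (ι, j, k) x)
    _ = ENNReal.ofReal (C * 2 ^ j) * ((∑' k : ℤ, ENNReal.ofReal ((1 + (2 ^ j * x 0 - k) ^ 2)⁻¹)) *
          ∑' k : ℤ, ENNReal.ofReal ((1 + (2 ^ j * x 1 - k) ^ 2)⁻¹)) := by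
        rw [ENNReal.tsum_mul_left, ENNReal.tsum_prod']
        simp_rw [ENNReal.tsum_mul_left, ENNReal.tsum_mul_right]
    _ ≤ ENNReal.ofReal (C * 2 ^ j) * (D * D) := by
        gcongr
        · exact hDb _
        · exact hDb _
    _ = _ := by rw [ENNReal.ofReal_mul hC0]; ring

/-! ### Mass of wavelets in vertical strips -/

lemma lintegral_plane_mul {f g : ℝ → ℝ≥0∞} (hf : Measurable f) (hg : Measurable g) :
    ∫⁻ x : Plane, f (x 0) * g (x 1) = (∫⁻ t, f t) * ∫⁻ t, g t := by
  rw [← lintegral_prod_mul hf.aemeasurable hg.aemeasurable,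
    ← (PiLp.volume_preserving_toLp (Fin 2)).lintegral_comp_emb
      (MeasurableEquiv.toLp 2 (Fin 2 → ℝ)).measurableEmbedding,
    ← Measure.volume_eq_prod, ← (volume_preserving_finTwoArrow ℝ).lintegral_comp_emb
      (MeasurableEquiv.finTwoArrow).measurableEmbedding]
  rfl

/-- The amplitude `R` cancels the dilation in one variable exactly. This is why the strip estimate
does not depend on the scale of the wavelet. -/
lemma lintegral_dilate_inv_one_add_sq {R : ℝ} (hR : 0 < R) (k : ℝ) :
    ∫⁻ t : ℝ, ENNReal.ofReal R * ENNReal.ofReal ((1 + (R * t - k) ^ 2)⁻¹) =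
      ∫⁻ t : ℝ, ENNReal.ofReal ((1 + t ^ 2)⁻¹) := by
  rw [lintegral_const_mul' _ _ ENNReal.ofReal_ne_top]
  have := lintegral_comp_smul_of_pos volume
    (fun t : ℝ => ENNReal.ofReal ((1 + (t - k) ^ 2)⁻¹)) hR
  simp only [Module.finrank_self, pow_one, smul_eq_mul] at this
  rw [this, lintegral_sub_right_eq_self (fun t : ℝ => ENNReal.ofReal ((1 + t ^ 2)⁻¹))]

lemma measurableSet_strip (h : ℝ) : MeasurableSet (strip h) := by
  have : Measurable fun x : Plane => |x 0| := by fun_prop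
  exact measurableSet_le this measurable_const

/-- The mass of any wavelet in a vertical strip is controlled by the width of the strip. -/
lemma setLIntegral_strip_wavelet_le (hν : IsMeyerAux ν) : ∃ C : ℝ≥0∞, C ≠ ⊤ ∧
    ∀ (lam : WaveletIndex) (h : ℝ),
      ∫⁻ x in strip h, ‖wavelet ν lam x‖ₑ ≤ C * ENNReal.ofReal h := by
  obtain ⟨C, hC0, hC⟩ := wavelet_decay hν
  refine ⟨ENNReal.ofReal C * (2 * ∫⁻ t : ℝ, ENNReal.ofReal ((1 + t ^ 2)⁻¹)), ?_, fun lam h => ?_⟩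
  · refine ENNReal.mul_ne_top ENNReal.ofReal_ne_top (ENNReal.mul_ne_top (by norm_num) ?_)
    exact (integrable_inv_one_add_sq.lintegral_lt_top).ne
  set R : ℝ := 2 ^ lam.2.1 with hR
  have hRpos : 0 < R := by positivity
  calc ∫⁻ x in strip h, ‖wavelet ν lam x‖ₑ
      ≤ ∫⁻ x in strip h, ENNReal.ofReal C * (ENNReal.ofReal R *
        ENNReal.ofReal ((1 + (R * x 1 - lam.2.2.2) ^ 2)⁻¹)) := by
        refine lintegral_mono fun x => ?_
        rw [← ENNReal.ofReal_mul (by positivity), ← ENNReal.ofReal_mul (by positivity),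
          ← ofReal_norm]
        refine ENNReal.ofReal_le_ofReal ((hC lam x).trans ?_)
        rw [mul_assoc]
        gcongr
        -- Decay across the strip is discarded: in that direction only the width `2h` is used.
        refine mul_le_of_le_one_left (by positivity) ?_
        exact inv_le_one_of_one_le₀ (by nlinarith [sq_nonneg (2 ^ lam.2.1 * x 0 - lam.2.2.1)])
    _ = ENNReal.ofReal C * ∫⁻ x : Plane, (Set.Icc (-h) h).indicator 1 (x 0) *
          (ENNReal.ofReal R * ENNReal.ofReal ((1 + (R * x 1 - lam.2.2.2) ^ 2)⁻¹)) := by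
        rw [lintegral_const_mul' _ _ ENNReal.ofReal_ne_top,
          ← lintegral_indicator (measurableSet_strip h)]
        congr 1
        refine lintegral_congr fun x => ?_
        by_cases hx : |x 0| ≤ h
        · rw [Set.indicator_of_mem (show x ∈ strip h from hx),
            Set.indicator_of_mem (show x 0 ∈ Set.Icc (-h) h from abs_le.1 hx)]
          simp
        · rw [Set.indicator_of_notMem (show x ∉ strip h from hx),
            Set.indicator_of_notMem
              (show x 0 ∉ Set.Icc (-h) h from fun h' => hx (abs_le.2 h'))]
          simp
    _ = ENNReal.ofReal C * ((ENNReal.ofReal (2 * h)) *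
          ∫⁻ t : ℝ, ENNReal.ofReal ((1 + t ^ 2)⁻¹)) := by
        rw [lintegral_plane_mul
          (f := (Set.Icc (-h) h).indicator 1)
          (g := fun t => ENNReal.ofReal R * ENNReal.ofReal ((1 + (R * t - lam.2.2.2) ^ 2)⁻¹))
          (measurable_one.indicator measurableSet_Icc) (by fun_prop),
          lintegral_dilate_inv_one_add_sq hRpos, lintegral_indicator_one measurableSet_Icc,
          Real.volume_Icc]
        congr 3
        ring
    _ = _ := by
        rw [ENNReal.ofReal_mul (by norm_num), ENNReal.ofReal_ofNat]; ring

/-! ### Recovery by analysis `ℓ₁` minimization for Parseval frames -/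

/-- Polarization, applied both to the energy identity in `H` and to each scalar term. -/
lemma hasSum_inner_mul_inner_of_parseval {I H : Type*} [NormedAddCommGroup H]
    [InnerProductSpace ℂ H] {v : I → H}
    (hv : ∀ z, HasSum (fun i => ‖inner ℂ (v i) z‖ ^ 2) (‖z‖ ^ 2)) (f g : H) :
    HasSum (fun i => inner ℂ f (v i) * inner ℂ (v i) g) (inner ℂ f g) := by
  have h : ∀ z, HasSum (fun i => ((‖inner ℂ (v i) z‖ : ℂ)) ^ 2) ((‖z‖ : ℂ) ^ 2) := fun z => by
    have := Complex.hasSum_ofReal.2 (hv z)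
    simpa using this
  have key := (((h (f + g)).sub (h (f - g))).add
    (((h (f - (Complex.I : ℂ) • g)).sub (h (f + (Complex.I : ℂ) • g))).mul_right
      Complex.I)).div_const 4
  have e := inner_eq_sum_norm_sq_div_four (𝕜 := ℂ) f g
  simp only [RCLike.I_to_complex, Complex.coe_algebraMap] at e
  rw [e]
  refine key.congr_fun fun i => ?_
  have e' := inner_eq_sum_norm_sq_div_four (𝕜 := ℂ) (inner ℂ (v i) f) (inner ℂ (v i) g)
  simp only [RCLike.I_to_complex, RCLike.ofReal_eq_complex_ofReal] at e'
  simp only [inner_add_right, inner_sub_right, inner_smul_right]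
  simp only [smul_eq_mul] at e'
  rw [← e', RCLike.inner_apply, inner_conj_symm, mul_comm]

/-- A family of functions on the plane forming a Parseval frame of `L²(ℝ²)`. -/
structure IsParsevalFrame {I : Type} (ψ : I → Plane → ℂ) : Prop where
  memLp : ∀ i, MemLp (ψ i) 2 volume
  energy : ∀ f : Plane → ℂ, MemLp f 2 volume →
    ∑' i, ‖coeff f (ψ i)‖ₑ ^ 2 = eLpNorm f 2 volume ^ 2

lemma inner_toLp_eq_coeff {f g : Plane → ℂ} (hf : MemLp f 2 volume) (hg : MemLp g 2 volume) :
    inner ℂ (hg.toLp g) (hf.toLp f) = coeff f g := by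
  rw [L2.inner_def, coeff]
  refine integral_congr_ae ?_
  filter_upwards [hf.coeFn_toLp, hg.coeFn_toLp] with x h1 h2
  simp [h1, h2]

lemma integrable_mul_conj {f g : Plane → ℂ} (hf : MemLp f 2 volume) (hg : MemLp g 2 volume) :
    Integrable (fun x => f x * conj (g x)) volume :=
  hf.integrable_mul hg.star

lemma coeff_add {f g φ : Plane → ℂ} (hf : MemLp f 2 volume) (hg : MemLp g 2 volume)
    (hφ : MemLp φ 2 volume) : coeff (f + g) φ = coeff f φ + coeff g φ := by
  simp only [coeff, Pi.add_apply, add_mul]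
  exact integral_add (integrable_mul_conj hf hφ) (integrable_mul_conj hg hφ)

variable {I : Type} {ψ : I → Plane → ℂ}

lemma IsParsevalFrame.hasSum_coeff_mul (hψ : IsParsevalFrame ψ) {f g : Plane → ℂ}
    (hf : MemLp f 2 volume) (hg : MemLp g 2 volume) :
    HasSum (fun i => coeff f (ψ i) * conj (coeff g (ψ i))) (coeff f g) := by
  have hv : ∀ z : Lp ℂ 2 (volume : Measure Plane),
      HasSum (fun i => ‖inner ℂ ((hψ.memLp i).toLp (ψ i)) z‖ ^ 2) (‖z‖ ^ 2) := by
    intro z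
    have h1 : ∀ i, inner ℂ ((hψ.memLp i).toLp (ψ i)) z = coeff z (ψ i) := fun i => by
      rw [← inner_toLp_eq_coeff (Lp.memLp z), Lp.toLp_coeFn]
    simp_rw [h1]
    have h2 := hψ.energy z (Lp.memLp z)
    have h3 : ∀ i, ‖coeff z (ψ i)‖ₑ ^ 2 = ENNReal.ofReal (‖coeff z (ψ i)‖ ^ 2) := fun i => by
      rw [ENNReal.ofReal_pow (norm_nonneg _), ofReal_norm]
    have h4 : eLpNorm z 2 volume ^ 2 = ENNReal.ofReal (‖z‖ ^ 2) := by
      rw [ENNReal.ofReal_pow (norm_nonneg _), ofReal_norm, Lp.enorm_def]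
    simp_rw [h3] at h2
    rw [h4] at h2
    have hs : Summable fun i => ‖coeff z (ψ i)‖ ^ 2 := by
      have h5 : ∑' i, ENNReal.ofReal (‖coeff z (ψ i)‖ ^ 2) ≠ ⊤ := h2 ▸ ENNReal.ofReal_ne_top
      refine (ENNReal.summable_toReal h5).congr fun i => ?_
      rw [ENNReal.toReal_ofReal (by positivity)]
    rw [hs.hasSum_iff]
    rw [← ENNReal.ofReal_tsum_of_nonneg (fun i => by positivity) hs] at h2
    exact (ENNReal.ofReal_eq_ofReal_iff (tsum_nonneg fun i => by positivity) (by positivity)).1 h2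
  have h := hasSum_inner_mul_inner_of_parseval hv (hg.toLp g) (hf.toLp f)
  rw [inner_toLp_eq_coeff hf hg] at h
  refine h.congr_fun fun i => ?_
  rw [inner_toLp_eq_coeff hf (hψ.memLp i), ← inner_conj_symm, inner_toLp_eq_coeff hg (hψ.memLp i),
    mul_comm]

lemma IsParsevalFrame.enorm_coeff_le (hψ : IsParsevalFrame ψ) {f g : Plane → ℂ}
    (hf : MemLp f 2 volume) (hg : MemLp g 2 volume) :
    ‖coeff f g‖ₑ ≤ ∑' i, ‖coeff f (ψ i)‖ₑ * ‖coeff g (ψ i)‖ₑ := by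
  rw [← (hψ.hasSum_coeff_mul hf hg).tsum_eq]
  refine enorm_tsum_le_tsum_enorm.trans_eq (tsum_congr fun i => ?_)
  rw [enorm_mul, RCLike.enorm_conj]

/-- Analysis coefficients of functions supported in `M` do not concentrate on `Λ` if the part of
the frame indexed by `Λ` is pointwise bounded and the frame elements have small mass in `M`. -/
lemma IsParsevalFrame.tsum_indicator_enorm_coeff_le [Countable I] (hψ : IsParsevalFrame ψ)
    {M : Set Plane} (hM : MeasurableSet M) (Λ : Set I) {K B : ℝ≥0∞}
    (hK : ∀ x, ∑' i, Λ.indicator (fun i => ‖ψ i x‖ₑ) i ≤ K)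
    (hB : ∀ i, ∫⁻ x in M, ‖ψ i x‖ₑ ≤ B)
    {z : Plane → ℂ} (hz : MemLp z 2 volume) (hzM : Mᶜ.indicator z =ᵐ[volume] 0) :
    ∑' i, Λ.indicator (fun i => ‖coeff z (ψ i)‖ₑ) i ≤ K * B * analysisL1 ψ z := by
  have hm : ∀ i, MemLp (M.indicator (ψ i)) 2 volume := fun i => (hψ.memLp i).indicator hM
  -- As `z` lives in `M`, the frame element may be cut off to `M` before the Parseval expansion; the
  -- Gram entries then only see the mass in `M`.
  have h1 : ∀ i, coeff z (ψ i) = coeff z (M.indicator (ψ i)) := fun i => by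
    refine integral_congr_ae ?_
    filter_upwards [hzM] with x hx
    by_cases hxM : x ∈ M
    · simp [hxM]
    · have : z x = 0 := by simpa [hxM] using hx
      simp [this]
  have h2 : ∀ i l, ‖coeff (M.indicator (ψ i)) (ψ l)‖ₑ ≤ ∫⁻ x in M, ‖ψ i x‖ₑ * ‖ψ l x‖ₑ := by
    intro i l
    rw [← lintegral_indicator hM]
    refine (enorm_integral_le_lintegral_enorm _).trans (lintegral_mono fun x => ?_)
    by_cases hxM : x ∈ M <;> simp [hxM]
  have hmeas : ∀ i, AEMeasurable (fun x => ‖ψ i x‖ₑ) (volume.restrict M) := fun i =>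
    (hψ.memLp i).1.enorm.restrict
  calc ∑' i, Λ.indicator (fun i => ‖coeff z (ψ i)‖ₑ) i
      ≤ ∑' i, ∑' l, ‖coeff z (ψ l)‖ₑ *
          ∫⁻ x in M, Λ.indicator (fun i => ‖ψ i x‖ₑ) i * ‖ψ l x‖ₑ := by
        refine ENNReal.tsum_le_tsum fun i => ?_
        by_cases hi : i ∈ Λ
        · simp only [Set.indicator_of_mem hi]
          rw [h1]
          refine (hψ.enorm_coeff_le hz (hm i)).trans (ENNReal.tsum_le_tsum fun l => ?_)
          gcongr
          exact h2 i l
        · simp [Set.indicator_of_notMem hi]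
    _ = ∑' l, ‖coeff z (ψ l)‖ₑ *
          ∫⁻ x in M, (∑' i, Λ.indicator (fun i => ‖ψ i x‖ₑ) i) * ‖ψ l x‖ₑ := by
        -- Summing over `i ∈ Λ` first allows the pointwise bound `K` under the integral; what
        -- remains is the mass of `ψ l` in `M`.
        rw [ENNReal.tsum_comm]
        refine tsum_congr fun l => ?_
        rw [ENNReal.tsum_mul_left, ← lintegral_tsum]
        · simp_rw [ENNReal.tsum_mul_right]
        · intro i
          refine AEMeasurable.mul ?_ (hmeas l)
          by_cases hi : i ∈ Λ
          · simpa only [Set.indicator_of_mem hi] using hmeas i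
          · simp [Set.indicator_of_notMem hi]
    _ ≤ ∑' l, ‖coeff z (ψ l)‖ₑ * (K * B) := by
        refine ENNReal.tsum_le_tsum fun l => ?_
        gcongr
        calc _ ≤ ∫⁻ x in M, K * ‖ψ l x‖ₑ := lintegral_mono fun x => by gcongr; exact hK x
          _ = K * ∫⁻ x in M, ‖ψ l x‖ₑ := lintegral_const_mul'' _ (hmeas l)
          _ ≤ K * B := by gcongr; exact hB l
    _ = _ := by rw [ENNReal.tsum_mul_right, analysisL1, mul_comm]

lemma tsum_indicator_add_compl (Λ : Set I) (a : I → ℝ≥0∞) :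
    ∑' i, a i = ∑' i, Λ.indicator a i + ∑' i, Λᶜ.indicator a i := by
  rw [← ENNReal.tsum_add]
  exact tsum_congr fun i => (congrFun (Set.indicator_self_add_compl Λ a) i).symm

/-- If a sequence is supported on `Λ` and a perturbation has little mass on `Λ`, then the
perturbation increases the `ℓ₁` norm. -/
lemma tsum_enorm_add_half_le {Λ : Set I} {a z : I → ℂ} (ha : ∀ i, i ∉ Λ → a i = 0)
    (hz : ∑' i, Λ.indicator (fun i => ‖z i‖ₑ) i ≤ 4⁻¹ * ∑' i, ‖z i‖ₑ)
    (hzfin : ∑' i, ‖z i‖ₑ ≠ ⊤) :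
    ∑' i, ‖a i‖ₑ + 2⁻¹ * ∑' i, ‖z i‖ₑ ≤ ∑' i, ‖a i + z i‖ₑ := by
  set S := ∑' i, Λ.indicator (fun i => ‖z i‖ₑ) i with hS
  set T := ∑' i, Λᶜ.indicator (fun i => ‖z i‖ₑ) i with hT
  have hST : ∑' i, ‖z i‖ₑ = S + T := tsum_indicator_add_compl Λ _
  -- Triangle inequality on `Λ`, equality off `Λ` where `a` vanishes. Since `S ≤ (S + T)/4`, the
  -- gain `T - S` is at least `(S + T)/2`; finiteness permits the subtraction.
  have h1 : ∑' i, ‖a i‖ₑ + T ≤ ∑' i, ‖a i + z i‖ₑ + S := by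
    rw [hS, hT, ← ENNReal.tsum_add, ← ENNReal.tsum_add]
    refine ENNReal.tsum_le_tsum fun i => ?_
    by_cases hi : i ∈ Λ
    · simp only [Set.indicator_of_mem hi, Set.indicator_of_notMem (fun h : i ∈ Λᶜ => h hi),
        add_zero]
      calc ‖a i‖ₑ = ‖(a i + z i) - z i‖ₑ := by rw [add_sub_cancel_right]
        _ ≤ _ := enorm_sub_le
    · simp [Set.indicator_of_notMem hi, Set.indicator_of_mem (show i ∈ Λᶜ from hi), ha i hi]
  rw [hST] at hz hzfin ⊢
  have hSfin : S ≠ ⊤ := fun h => hzfin (by simp [h])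
  have hTfin : T ≠ ⊤ := fun h => hzfin (by simp [h])
  rcases eq_or_ne (∑' i, ‖a i + z i‖ₑ) ⊤ with h | h
  · rw [h]; exact le_top
  have hafin : ∑' i, ‖a i‖ₑ ≠ ⊤ := fun h' => by
    rw [h', top_add, top_le_iff] at h1
    exact (ENNReal.add_ne_top.2 ⟨h, hSfin⟩) h1
  clear_value S T
  lift S to NNReal using hSfin
  lift T to NNReal using hTfin
  generalize (∑' i, ‖a i‖ₑ) = A at *
  generalize (∑' i, ‖a i + z i‖ₑ) = A' at *
  lift A to NNReal using hafin
  lift A' to NNReal using h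
  have e4 : (4⁻¹ : ℝ≥0∞) = ((4⁻¹ : NNReal) : ℝ≥0∞) := by simp
  have e2 : (2⁻¹ : ℝ≥0∞) = ((2⁻¹ : NNReal) : ℝ≥0∞) := by simp
  rw [e4] at hz
  rw [e2]
  norm_cast at hz h1 ⊢
  rw [← NNReal.coe_le_coe] at hz h1 ⊢
  push_cast at hz h1 ⊢
  linarith

/-- Exact recovery: a signal whose coefficients are supported on a set of coefficients on which
functions living in the missing part do not concentrate is the unique minimizer. -/
theorem IsParsevalFrame.solvesInp_self_and_unique (hψ : IsParsevalFrame ψ) {M : Set Plane}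
    {Λ : Set I} {x₀ : Plane → ℂ} (hx₀ : MemLp x₀ 2 volume) (hfin : analysisL1 ψ x₀ ≠ ⊤)
    (hsupp : ∀ i, i ∉ Λ → coeff x₀ (ψ i) = 0)
    (hconc : ∀ z : Plane → ℂ, MemLp z 2 volume → Mᶜ.indicator z =ᵐ[volume] 0 →
      ∑' i, Λ.indicator (fun i => ‖coeff z (ψ i)‖ₑ) i ≤ 4⁻¹ * analysisL1 ψ z) :
    SolvesInp ψ M x₀ x₀ ∧ ∀ L, SolvesInp ψ M x₀ L → L =ᵐ[volume] x₀ := by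
  -- A quantitative form of minimality: the excess controls the coefficient norm of the difference,
  -- so it yields uniqueness as well.
  have key : ∀ L, MemLp L 2 volume → SameKnownPart M L x₀ → analysisL1 ψ L ≠ ⊤ →
      analysisL1 ψ x₀ + 2⁻¹ * analysisL1 ψ (L - x₀) ≤ analysisL1 ψ L := by
    intro L hL hLM hLfin
    have hz := hL.sub hx₀
    have hadd : ∀ i, coeff x₀ (ψ i) + coeff (L - x₀) (ψ i) = coeff L (ψ i) := fun i => by
      rw [← coeff_add hx₀ hz (hψ.memLp i), add_sub_cancel]
    have hzM : Mᶜ.indicator (L - x₀) =ᵐ[volume] 0 := by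
      filter_upwards [hLM] with x hx
      rw [Set.indicator_sub', Pi.sub_apply, hx, sub_self, Pi.zero_apply]
    have hzfin : analysisL1 ψ (L - x₀) ≠ ⊤ := by
      refine ne_top_of_le_ne_top (ENNReal.add_ne_top.2 ⟨hLfin, hfin⟩) ?_
      rw [analysisL1, analysisL1, analysisL1, ← ENNReal.tsum_add]
      refine ENNReal.tsum_le_tsum fun i => ?_
      rw [eq_sub_of_add_eq' (hadd i)]
      exact enorm_sub_le
    have := tsum_enorm_add_half_le hsupp (hconc _ hz hzM) hzfin
    simpa only [hadd] using! this
  have hself : SolvesInp ψ M x₀ x₀ := by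
    refine ⟨hx₀, EventuallyEq.rfl, fun L' hL' hM' => ?_⟩
    rcases eq_or_ne (analysisL1 ψ L') ⊤ with h | h
    · rw [h]; exact le_top
    · exact le_self_add.trans (key L' hL' hM' h)
  refine ⟨hself, fun L hL => ?_⟩
  have hle := hL.minimal x₀ hx₀ EventuallyEq.rfl
  have h1 := (key L hL.memLp hL.feasible (ne_top_of_le_ne_top hfin hle)).trans hle
  have h2 : analysisL1 ψ (L - x₀) = 0 := by
    by_contra h0
    have h3 : (2⁻¹ : ℝ≥0∞) * analysisL1 ψ (L - x₀) ≠ 0 := mul_ne_zero (by simp) h0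
    exact absurd h1 (not_le.2 (ENNReal.lt_add_right hfin h3))
  have hz := hL.memLp.sub hx₀
  -- Vanishing coefficients force a vanishing `L²` norm by the Parseval identity.
  have h3 : eLpNorm (L - x₀) 2 volume = 0 := by
    have h4 := hψ.energy _ hz
    rw [analysisL1, ENNReal.tsum_eq_zero] at h2
    simp only [h2] at h4
    simpa using h4.symm
  rw [eLpNorm_eq_zero_iff hz.1 (by norm_num)] at h3
  filter_upwards [h3] with x hx
  exact sub_eq_zero.1 hx

/-! ### The Meyer system as a Parseval frame -/

lemma memLp_wavelet (hν : IsMeyerAux ν) (lam : WaveletIndex) : MemLp (wavelet ν lam) 2 volume := by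
  rw [← coe_waveletS hν]
  exact (waveletS hν lam).memLp 2 volume

lemma inner_waveletS (hν : IsMeyerAux ν) {f : Plane → ℂ} (hf : MemLp f 2 volume)
    (lam : WaveletIndex) :
    inner ℂ ((waveletS hν lam).toLp 2) (hf.toLp f) = coeff f (wavelet ν lam) := by
  rw [← coe_waveletS hν]
  exact inner_toLp_eq_coeff hf _

theorem isParsevalFrame_wavelet (hν : IsMeyerAux ν) : IsParsevalFrame (wavelet ν) := by
  refine ⟨memLp_wavelet hν, fun f hf => ?_⟩
  have h1 := tsum_enorm_sq_inner_wavelet hν (hf.toLp f)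
  rw [Lp.enorm_toLp] at h1
  rw [← h1]
  refine tsum_congr fun lam => ?_
  rw [inner_waveletS hν hf]

/-- The wavelet indices whose scale lies in a given finite set. -/
def scaleIndices (S : Finset ℤ) : Set WaveletIndex := {lam | lam.2.1 ∈ S}

lemma tsum_indicator_scaleIndices_le {S : Finset ℤ} {a : WaveletIndex → ℝ≥0∞} {K : ℝ≥0∞}
    (ha : ∀ ι, ∀ j ∈ S, ∑' k : ℤ × ℤ, a (ι, j, k) ≤ K) :
    ∑' lam, (scaleIndices S).indicator a lam ≤ 3 * (S.card * K) := by
  rw [tsum_waveletIndex, ENNReal.tsum_prod']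
  calc ∑' (ι : Orient) (j : ℤ), ∑' k : ℤ × ℤ, (scaleIndices S).indicator a (ι, j, k)
      ≤ ∑' (_ : Orient), (S.card * K : ℝ≥0∞) := by
        refine ENNReal.tsum_le_tsum fun ι => ?_
        rw [tsum_eq_sum (s := S)]
        · rw [← nsmul_eq_mul]
          refine Finset.sum_le_card_nsmul _ _ _ fun j hj => ?_
          refine le_of_eq_of_le (tsum_congr fun k => ?_) (ha ι j hj)
          exact Set.indicator_of_mem (show (ι, j, k) ∈ scaleIndices S from hj) _
        · intro j hj
          refine ENNReal.tsum_eq_zero.2 fun k => ?_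
          exact Set.indicator_of_notMem (show (ι, j, k) ∉ scaleIndices S from hj) _
    _ = 3 * (S.card * K) := by
        rw [tsum_fintype, sum_orient]; ring

/-- The scales meeting the pass band of the `j`-th filter. -/
def bandScales (j : ℕ) : Finset ℤ := Finset.Icc (2 * j - 1) (2 * j + 2)

/-- Only four scales occur, each contributing at most a multiple of `2^{2j+2}`. This is the growth
that the strip width has to beat. -/
lemma tsum_indicator_enorm_wavelet_le (hν : IsMeyerAux ν) : ∃ C : ℝ≥0∞, C ≠ ⊤ ∧
    ∀ (j : ℕ) (x : Plane),
      ∑' lam, (scaleIndices (bandScales j)).indicator (fun lam => ‖wavelet ν lam x‖ₑ) lam ≤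
        C * ENNReal.ofReal (2 ^ (2 * (j : ℤ))) := by
  obtain ⟨C, hC, hb⟩ := tsum_enorm_wavelet_le hν
  refine ⟨3 * (4 * (C * 4)), by finiteness, fun j x => ?_⟩
  have hcard : (bandScales j).card = 4 := by
    rw [bandScales, Int.card_Icc]; ring_nf; rfl
  have h4 : ENNReal.ofReal (2 ^ (2 * (j : ℤ) + 2)) = 4 * ENNReal.ofReal (2 ^ (2 * (j : ℤ))) := by
    rw [zpow_add₀ two_ne_zero, mul_comm, ENNReal.ofReal_mul (by norm_num)]
    norm_num
  refine (tsum_indicator_scaleIndices_le (K := C * ENNReal.ofReal (2 ^ (2 * (j : ℤ) + 2)))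
    fun ι i hi => (hb ι i x).trans ?_).trans_eq ?_
  · gcongr
    · norm_num
    · exact (Finset.mem_Icc.1 hi).2
  · rw [hcard, h4]
    push_cast
    ring

/-- Exchange of sum and integral; it supplies the finiteness of the coefficient norm of the filtered
line, which is an `L¹` function. -/
lemma tsum_indicator_enorm_coeff_le_of_bound {I : Type} [Countable I] {ψ : I → Plane → ℂ}
    (hψ : ∀ i, AEStronglyMeasurable (ψ i) volume) (Λ : Set I) {K : ℝ≥0∞}
    (hK : ∀ x, ∑' i, Λ.indicator (fun i => ‖ψ i x‖ₑ) i ≤ K)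
    {f : Plane → ℂ} (hf : AEStronglyMeasurable f volume) :
    ∑' i, Λ.indicator (fun i => ‖coeff f (ψ i)‖ₑ) i ≤ (∫⁻ x, ‖f x‖ₑ) * K := by
  calc ∑' i, Λ.indicator (fun i => ‖coeff f (ψ i)‖ₑ) i
      ≤ ∑' i, ∫⁻ x, ‖f x‖ₑ * Λ.indicator (fun i => ‖ψ i x‖ₑ) i := by
        refine ENNReal.tsum_le_tsum fun i => ?_
        by_cases hi : i ∈ Λ
        · simp only [Set.indicator_of_mem hi]
          refine (enorm_integral_le_lintegral_enorm _).trans_eq (lintegral_congr fun x => ?_)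
          rw [enorm_mul, RCLike.enorm_conj]
        · simp [Set.indicator_of_notMem hi]
    _ = ∫⁻ x, ‖f x‖ₑ * ∑' i, Λ.indicator (fun i => ‖ψ i x‖ₑ) i := by
        rw [← lintegral_tsum]
        · simp_rw [ENNReal.tsum_mul_left]
        · intro i
          refine hf.enorm.mul ?_
          by_cases hi : i ∈ Λ
          · simpa only [Set.indicator_of_mem hi] using (hψ i).enorm
          · simp [Set.indicator_of_notMem hi]
    _ ≤ ∫⁻ x, ‖f x‖ₑ * K := lintegral_mono fun x => by gcongr; exact hK x
    _ = _ := lintegral_mul_const'' _ hf.enorm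

/-! ### The filtered line singularity in the Fourier domain -/

lemma contDiff_bandFilter (hν : IsMeyerAux ν) (j : ℕ) : ContDiff ℝ ∞ (bandFilter ν j) := by
  have h1 := contDiff_meyerW2 hν Orient.h
  have h2 := contDiff_meyerW2 hν Orient.v
  have h3 := contDiff_meyerW2 hν Orient.d
  unfold bandFilter
  fun_prop

lemma bandFilter_eq_zero_of_ge (hν : IsMeyerAux ν) (j : ℕ) {ξ : Plane} (i : Fin 2)
    (h : (2 : ℝ) ^ (2 * j + 1) / 4 ≤ |ξ i|) : bandFilter ν j ξ = 0 := by
  have h1 : ∀ ι, meyerW2 ν ι (((2 : ℝ) ^ (2 * j))⁻¹ • ξ) = 0 := fun ι => by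
    refine meyerW2_eq_zero_of_ge hν ι i ?_
    have : (0 : ℝ) < 2 ^ (2 * j) := by positivity
    rw [PiLp.smul_apply, smul_eq_mul, abs_mul, abs_of_pos (by positivity), le_inv_mul_iff₀ this]
    rw [pow_succ] at h
    linarith
  have h2 : ∀ ι, meyerW2 ν ι (((2 : ℝ) ^ (2 * j + 1))⁻¹ • ξ) = 0 := fun ι => by
    refine meyerW2_eq_zero_of_ge hν ι i ?_
    have : (0 : ℝ) < 2 ^ (2 * j + 1) := by positivity
    rw [PiLp.smul_apply, smul_eq_mul, abs_mul, abs_of_pos (by positivity), le_inv_mul_iff₀ this]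
    linarith
  simp [bandFilter, h1, h2]

lemma bandFilter_eq_zero_of_le (hν : IsMeyerAux ν) (j : ℕ) {ξ : Plane}
    (h : ∀ i, |ξ i| ≤ (2 : ℝ) ^ (2 * j) / 16) : bandFilter ν j ξ = 0 := by
  have h1 : ∀ i, |(((2 : ℝ) ^ (2 * j))⁻¹ • ξ) i| ≤ 1 / 16 := fun i => by
    have : (0 : ℝ) < 2 ^ (2 * j) := by positivity
    rw [PiLp.smul_apply, smul_eq_mul, abs_mul, abs_of_pos (by positivity), inv_mul_le_iff₀ this]
    linarith [h i]
  have h2 : ∀ i, |(((2 : ℝ) ^ (2 * j + 1))⁻¹ • ξ) i| ≤ 1 / 16 := fun i => by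
    have : (0 : ℝ) < 2 ^ (2 * j + 1) := by positivity
    rw [PiLp.smul_apply, smul_eq_mul, abs_mul, abs_of_pos (by positivity), inv_mul_le_iff₀ this,
      pow_succ]
    linarith [h i, (by positivity : (0 : ℝ) < 2 ^ (2 * j))]
  simp only [bandFilter, meyerW2_eq_zero_of_le hν _ (h1 0) (h1 1),
    meyerW2_eq_zero_of_le hν _ (h2 0) (h2 1), add_zero]

/-- The filter is nonzero at the centre of its pass band on the vertical frequency axis, and at
neighbouring frequencies. -/
lemma bandFilter_ne_zero (hν : IsMeyerAux ν) (j : ℕ) {s : ℝ} (hs : |s| ≤ 2 ^ (2 * j) / 16) :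
    bandFilter ν j !₂[s, 2 ^ (2 * j) / 8] ≠ 0 := by
  have hp : (0 : ℝ) < 2 ^ (2 * j) := by positivity
  have hs1 : |((2 : ℝ) ^ (2 * j))⁻¹ * s| ≤ 1 / 16 := by
    rw [abs_mul, abs_of_pos (by positivity), inv_mul_le_iff₀ hp]; linarith
  have hs2 : |((2 : ℝ) ^ (2 * j + 1))⁻¹ * s| ≤ 1 / 16 := by
    rw [abs_mul, abs_of_pos (by positivity), inv_mul_le_iff₀ (by positivity), pow_succ]; linarith
  -- The vertical frequency is chosen so that the coarser dilate hits `1/8`, where `|W| = 1`, and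
  -- the finer one hits `1/16`, where `W = 0`. With the horizontal factors `W` also zero, a single
  -- term survives and nothing can cancel.
  have ht1 : ((2 : ℝ) ^ (2 * j))⁻¹ * (2 ^ (2 * j) / 8) = 1 / 8 := by field_simp
  have ht2 : ((2 : ℝ) ^ (2 * j + 1))⁻¹ * (2 ^ (2 * j) / 8) = 1 / 16 := by
    rw [pow_succ]; field_simp; norm_num
  have hW : meyerW ν (1 / 16) = 0 :=
    meyerW_eq_zero_of_le hν (by norm_num [abs_of_pos])
  have : bandFilter ν j !₂[s, 2 ^ (2 * j) / 8] = meyerW ν (1 / 8) := by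
    simp only [bandFilter, meyerW2, PiLp.smul_apply, smul_eq_mul, 
      Matrix.cons_val_zero, Matrix.cons_val_one, ht1, ht2, hW, meyerW_eq_zero_of_le hν hs1,
      meyerW_eq_zero_of_le hν hs2, meyerPhiHat_eq_one hν hs1]
    ring
  rw [this, meyerW_eq hν, abs_of_pos (by norm_num), hν.eq_one (16 * (1 / 8) - 1) (by norm_num),
    hν.eq_zero (8 * (1 / 8) - 1) (by norm_num)]
  simp [Complex.exp_ne_zero]

variable {w : ℝ → ℝ} {ρ : ℝ}

lemma hasCompactSupport_ofReal (hw_supp : Function.support w ⊆ Set.Icc (-ρ) ρ) :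
    HasCompactSupport fun t => (w t : ℂ) :=
  HasCompactSupport.of_support_subset_isCompact isCompact_Icc fun t ht =>
    hw_supp fun h0 => ht (by simp [h0])

/-- The window `w` as a complex Schwartz function. -/
def windowS (hw : ContDiff ℝ ∞ w) (hw_supp : Function.support w ⊆ Set.Icc (-ρ) ρ) :
    SchwartzMap ℝ ℂ :=
  (hasCompactSupport_ofReal hw_supp).toSchwartzMap (Complex.ofRealCLM.contDiff.comp hw)

lemma coe_windowS (hw : ContDiff ℝ ∞ w) (hw_supp : Function.support w ⊆ Set.Icc (-ρ) ρ) :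
    (windowS hw hw_supp : ℝ → ℂ) = fun t => (w t : ℂ) := rfl

/-- The Fourier transform of the filtered line singularity. -/
def filteredLineHatS (hν : IsMeyerAux ν) (hw : ContDiff ℝ ∞ w)
    (hw_supp : Function.support w ⊆ Set.Icc (-ρ) ρ) (j : ℕ) : SchwartzMap Plane ℂ :=
  HasCompactSupport.toSchwartzMap
    (f := fun ξ : Plane => (𝓕 (windowS hw hw_supp)) (ξ 0) * bandFilter ν j ξ)
    (hasCompactSupport_of_coord fun ξ i h => by rw [bandFilter_eq_zero_of_ge hν j i h, mul_zero])
    ((((𝓕 (windowS hw hw_supp)).smooth _).comp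
      (by fun_prop : ContDiff ℝ ∞ fun ξ : Plane => ξ 0)).mul (contDiff_bandFilter hν j))

lemma filteredLineHatS_apply (hν : IsMeyerAux ν) (hw : ContDiff ℝ ∞ w)
    (hw_supp : Function.support w ⊆ Set.Icc (-ρ) ρ) (j : ℕ) (ξ : Plane) :
    filteredLineHatS hν hw hw_supp j ξ = 𝓕 (windowS hw hw_supp) (ξ 0) * bandFilter ν j ξ := rfl

lemma lineSing_eq_integral (hρ : 0 < ρ) (hw_supp : Function.support w ⊆ Set.Icc (-ρ) ρ)
    (f : Plane → ℂ) : lineSing w ρ f = ∫ t, (w t : ℂ) * f !₂[t, 0] := by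
  rw [lineSing, intervalIntegral.integral_of_le (by linarith), ← integral_Icc_eq_integral_Ioc]
  refine setIntegral_eq_integral_of_forall_compl_eq_zero fun t ht => ?_
  have : w t = 0 := by
    by_contra h0
    exact ht (hw_supp h0)
  simp [this]

/-- The Fourier transform of the weighted line is `ŵ(ξ₁)`, constant in `ξ₂`, so filtering multiplies
it by `F_j`. The exchange of integrals is justified by the dominating function `|w(t)| |F_j(ξ)|`. -/
lemma filteredLine_eq (hν : IsMeyerAux ν) (hρ : 0 < ρ) (hw : ContDiff ℝ ∞ w)
    (hw_supp : Function.support w ⊆ Set.Icc (-ρ) ρ) (j : ℕ) :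
    filteredLine ν w ρ j = 𝓕⁻ (filteredLineHatS hν hw hw_supp j) := by
  ext x
  have hFc := (contDiff_bandFilter hν j).continuous
  have hwc := hw.continuous
  have hFint : Integrable (bandFilter ν j) volume :=
    hFc.integrable_of_hasCompactSupport
      (hasCompactSupport_of_coord fun ξ i h => bandFilter_eq_zero_of_ge hν j i h)
  have hwint : Integrable (fun t => (w t : ℂ)) volume := (windowS hw hw_supp).integrable
  have hprod : Integrable (Function.uncurry fun (t : ℝ) (ξ : Plane) => (w t : ℂ) *
      (Complex.exp (((2 * Real.pi * inner ℝ ξ (x - !₂[t, 0]) : ℝ) : ℂ) * Complex.I) *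
        bandFilter ν j ξ)) (volume.prod volume) := by
    refine (hwint.mul_prod hFint).mono (Continuous.aestronglyMeasurable ?_) (ae_of_all _ ?_)
    · simp only [Function.uncurry_def, PiLp.inner_apply, Fin.sum_univ_two, PiLp.sub_apply,
        Matrix.cons_val_zero, Matrix.cons_val_one, RCLike.inner_apply,
        conj_trivial]
      fun_prop
    · rintro ⟨t, ξ⟩
      simp only [Function.uncurry_apply_pair, norm_mul, Complex.norm_exp_ofReal_mul_I, one_mul,
        le_refl]
  rw [filteredLine, distribConv, lineSing_eq_integral hρ hw_supp, SchwartzMap.fourierInv_coe,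
    Real.fourierInv_eq']
  simp only [Real.fourierInv_eq', smul_eq_mul, ← integral_const_mul]
  rw [integral_integral_swap hprod]
  refine integral_congr_ae (ae_of_all _ fun ξ => ?_)
  simp only [filteredLineHatS_apply]
  rw [SchwartzMap.fourier_coe, Real.fourier_real_eq_integral_exp_smul, coe_windowS,
    mul_comm (∫ _, _), ← mul_assoc, ← integral_const_mul]
  refine integral_congr_ae (ae_of_all _ fun t => ?_)
  have hexp : Complex.exp (((2 * Real.pi * inner ℝ ξ (x - !₂[t, 0]) : ℝ) : ℂ) * Complex.I) =
      Complex.exp (((2 * Real.pi * inner ℝ ξ x : ℝ) : ℂ) * Complex.I) *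
        Complex.exp (((-2 * Real.pi * t * ξ 0 : ℝ) : ℂ) * Complex.I) := by
    rw [← Complex.exp_add]
    congr 1
    simp only [PiLp.inner_apply, Fin.sum_univ_two, PiLp.sub_apply, 
      Matrix.cons_val_zero, Matrix.cons_val_one, RCLike.inner_apply, conj_trivial]
    push_cast
    ring
  simp only [hexp, smul_eq_mul]
  ring

/-- By Plancherel it suffices that the Fourier supports do not meet. -/
lemma coeff_filteredLine_eq_zero (hν : IsMeyerAux ν) (hρ : 0 < ρ) (hw : ContDiff ℝ ∞ w)
    (hw_supp : Function.support w ⊆ Set.Icc (-ρ) ρ) (j : ℕ) {lam : WaveletIndex}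
    (hlam : lam ∉ scaleIndices (bandScales j)) :
    coeff (filteredLine ν w ρ j) (wavelet ν lam) = 0 := by
  rw [filteredLine_eq hν hρ hw hw_supp,
    ← inner_waveletS hν ((𝓕⁻ (filteredLineHatS hν hw hw_supp j)).memLp 2 volume)]
  change inner ℂ ((waveletS hν lam).toLp 2) ((𝓕⁻ (filteredLineHatS hν hw hw_supp j)).toLp 2) = 0
  rw [← Lp.inner_fourier_eq, SchwartzMap.toLp_fourier_eq, SchwartzMap.toLp_fourier_eq, waveletS,
    FourierTransform.fourier_fourierInv_eq, FourierTransform.fourier_fourierInv_eq,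
    inner_toLp_schwartz]
  refine integral_eq_zero_of_ae ?_
  filter_upwards [(filteredLineHatS hν hw hw_supp j).coeFn_toLp 2 volume] with ξ hξ
  rw [hξ, filteredLineHatS_apply, coe_waveletHatS, Pi.zero_apply]
  by_contra h0
  simp only [mul_eq_zero, not_or, map_eq_zero] at h0
  obtain ⟨⟨-, hF⟩, hψ⟩ := h0
  have hF1 : ∀ i, |ξ i| < (2 : ℝ) ^ (2 * j + 1) / 4 := fun i => by
    by_contra h
    exact hF (bandFilter_eq_zero_of_ge hν j i (not_lt.1 h))
  have hψ1 : ∀ i, |ξ i| < (2 : ℝ) ^ lam.2.1 / 4 := fun i => by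
    by_contra h
    exact hψ (waveletHat_eq_zero_of_ge hν lam i (not_lt.1 h))
  obtain ⟨i, hi⟩ : ∃ i, (2 : ℝ) ^ (2 * j) / 16 < |ξ i| := by
    by_contra! h
    exact hF (bandFilter_eq_zero_of_le hν j h)
  obtain ⟨l, hl⟩ : ∃ i, (2 : ℝ) ^ lam.2.1 / 16 < |ξ i| := by
    by_contra! h
    exact hψ (waveletHat_eq_zero_of_le hν lam h)
  -- At a common frequency the largest coordinate lies between `2^{2j}/16` and `2^{2j+1}/4`, and
  -- also between `2^{j'}/16` and `2^{j'}/4`. Hence `2j < j' + 2` and `j' < 2j + 3`, which over the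
  -- integers is `bandScales j`.
  refine hlam (show lam.2.1 ∈ bandScales j from Finset.mem_Icc.2 ⟨?_, ?_⟩)
  · have h2 : (2 : ℝ) ^ (2 * (j : ℤ)) < 2 ^ (lam.2.1 + 2) := by
      rw [zpow_add₀ two_ne_zero]
      have : (2 : ℝ) ^ (2 * (j : ℤ)) = 2 ^ (2 * j) := by norm_cast
      rw [this]
      norm_num
      linarith [hψ1 i]
    have := (zpow_lt_zpow_iff_right₀ (by norm_num : (1 : ℝ) < 2)).1 h2
    omega
  · have h2 : (2 : ℝ) ^ lam.2.1 < 2 ^ (2 * (j : ℤ) + 3) := by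
      have : (2 : ℝ) ^ (2 * (j : ℤ) + 3) = 4 * 2 ^ (2 * j + 1) := by
        rw [zpow_add₀ two_ne_zero, pow_succ]
        norm_cast
        ring
      rw [this]
      linarith [hF1 l]
    have := (zpow_lt_zpow_iff_right₀ (by norm_num : (1 : ℝ) < 2)).1 h2
    omega

lemma memLp_filteredLine (hν : IsMeyerAux ν) (hρ : 0 < ρ) (hw : ContDiff ℝ ∞ w)
    (hw_supp : Function.support w ⊆ Set.Icc (-ρ) ρ) (j : ℕ) (p : ℝ≥0∞) :
    MemLp (filteredLine ν w ρ j) p volume := by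
  rw [filteredLine_eq hν hρ hw hw_supp]
  exact SchwartzMap.memLp _ p volume

lemma analysisL1_filteredLine_ne_top (hν : IsMeyerAux ν) (hρ : 0 < ρ) (hw : ContDiff ℝ ∞ w)
    (hw_supp : Function.support w ⊆ Set.Icc (-ρ) ρ) (j : ℕ) :
    analysisL1 (wavelet ν) (filteredLine ν w ρ j) ≠ ⊤ := by
  obtain ⟨C, hC, hb⟩ := tsum_indicator_enorm_wavelet_le hν
  have h1 := memLp_filteredLine hν hρ hw hw_supp j 1
  have h2 := tsum_indicator_enorm_coeff_le_of_bound (fun lam => (memLp_wavelet hν lam).1)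
    (scaleIndices (bandScales j)) (hb j) h1.1
  have h3 : ∫⁻ x, ‖filteredLine ν w ρ j x‖ₑ ≠ ⊤ := by
    have := h1.2.ne
    rwa [eLpNorm_one_eq_lintegral_enorm] at this
  refine ne_top_of_le_ne_top
    (ENNReal.mul_ne_top h3 (ENNReal.mul_ne_top hC ENNReal.ofReal_ne_top)) (le_of_eq_of_le ?_ h2)
  refine tsum_congr fun lam => ?_
  by_cases hl : lam ∈ scaleIndices (bandScales j)
  · rw [Set.indicator_of_mem hl]
  · rw [Set.indicator_of_notMem hl, coeff_filteredLine_eq_zero hν hρ hw hw_supp j hl, enorm_zero]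

/-- Choose `s` with `ŵ(s) ≠ 0`. Once `4^j/16 ≥ |s|`, the product `ŵ(ξ₁) F_j(ξ)` is nonzero at `(s,
4^j/8)`, and injectivity of the Fourier transform concludes. -/
lemma eventually_eLpNorm_filteredLine_ne_zero (hν : IsMeyerAux ν) (hρ : 0 < ρ)
    (hw : ContDiff ℝ ∞ w) (hw_supp : Function.support w ⊆ Set.Icc (-ρ) ρ) (hw_ne : w ≠ 0) :
    ∀ᶠ j in atTop, eLpNorm (filteredLine ν w ρ j) 2 volume ≠ 0 := by
  obtain ⟨s, hs⟩ : ∃ s, 𝓕 (windowS hw hw_supp) s ≠ 0 := by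
    by_contra! h
    have h1 : 𝓕 (windowS hw hw_supp) = 0 := by ext s; simpa using h s
    have h2 : windowS hw hw_supp = 0 := by
      have h3 : 𝓕⁻ (𝓕 (windowS hw hw_supp)) = windowS hw hw_supp :=
        FourierTransform.fourierInv_fourier_eq _
      rw [← h3, h1]
      exact map_zero (FourierTransform.fourierInvCLM ℂ (SchwartzMap ℝ ℂ))
    refine hw_ne (funext fun t => ?_)
    have := congrArg (fun f : SchwartzMap ℝ ℂ => f t) h2
    simpa [coe_windowS] using this
  have hlim : Tendsto (fun j : ℕ => (4 : ℝ) ^ j / 16) atTop atTop :=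
    (tendsto_pow_atTop_atTop_of_one_lt (by norm_num)).atTop_div_const (by norm_num)
  filter_upwards [hlim.eventually_ge_atTop |s|] with j hj h0
  rw [filteredLine_eq hν hρ hw hw_supp,
    eLpNorm_eq_zero_iff (SchwartzMap.memLp _ 2 volume).1 (by norm_num)] at h0
  have h1 : 𝓕⁻ (filteredLineHatS hν hw hw_supp j) = 0 := by
    refine SchwartzMap.injective_toLp 2 volume (Lp.ext ?_)
    filter_upwards [h0, (𝓕⁻ (filteredLineHatS hν hw hw_supp j)).coeFn_toLp 2 volume,
      (0 : SchwartzMap Plane ℂ).coeFn_toLp 2 volume] with x h1 h2 h3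
    rw [h2, h3, h1]; rfl
  have h2 : filteredLineHatS hν hw hw_supp j = 0 := by
    have h3 : 𝓕 (𝓕⁻ (filteredLineHatS hν hw hw_supp j)) = filteredLineHatS hν hw hw_supp j :=
      FourierTransform.fourier_fourierInv_eq _
    rw [← h3, h1]
    exact map_zero (FourierTransform.fourierCLM ℂ (SchwartzMap Plane ℂ))
  have h3 := congrArg (fun f : SchwartzMap Plane ℂ => f !₂[s, 2 ^ (2 * j) / 8]) h2
  simp only [filteredLineHatS_apply, zero_apply] at h3
  refine mul_ne_zero ?_ (bandFilter_ne_zero hν j ?_) h3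
  · simpa using hs
  · rw [pow_mul]; norm_num; exact hj

/-! ### Exact recovery across thin strips -/

lemma eventually_const_mul_ofReal_le {h : ℕ → ℝ} (h_nonneg : ∀ j, 0 ≤ h j)
    (hh : h =o[atTop] fun j : ℕ => (2 : ℝ) ^ (-2 * (j : ℤ))) {A : ℝ≥0∞} (hA : A ≠ ⊤) :
    ∀ᶠ j : ℕ in atTop,
      A * (ENNReal.ofReal (2 ^ (2 * (j : ℤ))) * ENNReal.ofReal (h j)) ≤ 4⁻¹ := by
  -- Chosen so that `A ε ≤ 1/4`; the added 1 covers `A = 0`.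
  set ε : ℝ := (4 * (A.toReal + 1))⁻¹ with hε
  have hA0 : 0 ≤ A.toReal := ENNReal.toReal_nonneg
  filter_upwards [hh.bound (show 0 < ε by positivity)] with j hj
  rw [Real.norm_of_nonneg (h_nonneg j), Real.norm_of_nonneg (by positivity)] at hj
  have h1 : (2 : ℝ) ^ (2 * (j : ℤ)) * h j ≤ ε := by
    have h2 : (2 : ℝ) ^ (2 * (j : ℤ)) * 2 ^ (-2 * (j : ℤ)) = 1 := by
      rw [← zpow_add₀ two_ne_zero]; simp
    calc (2 : ℝ) ^ (2 * (j : ℤ)) * h j ≤ 2 ^ (2 * (j : ℤ)) * (ε * 2 ^ (-2 * (j : ℤ))) := by gcongr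
      _ = ε * (2 ^ (2 * (j : ℤ)) * 2 ^ (-2 * (j : ℤ))) := by ring
      _ = ε := by rw [h2, mul_one]
  have h4 : (4⁻¹ : ℝ≥0∞) = ENNReal.ofReal 4⁻¹ := by
    rw [ENNReal.ofReal_inv_of_pos (by norm_num)]; norm_num
  rw [← ENNReal.ofReal_mul (by positivity), ← ENNReal.ofReal_toReal hA, ← ENNReal.ofReal_mul hA0,
    h4]
  refine ENNReal.ofReal_le_ofReal ?_
  calc A.toReal * (2 ^ (2 * (j : ℤ)) * h j) ≤ A.toReal * ε := by gcongr
    _ ≤ 4⁻¹ := by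
      rw [hε, mul_inv, mul_left_comm]
      refine mul_le_of_le_one_right (by norm_num) ?_
      rw [← div_eq_mul_inv, div_le_one (by positivity)]
      linarith

/-- For thin strips, the filtered line singularity is the unique minimizer. -/
theorem eventually_exact_recovery (hν : IsMeyerAux ν) (hρ : 0 < ρ) (hw : ContDiff ℝ ∞ w)
    (hw_supp : Function.support w ⊆ Set.Icc (-ρ) ρ) {h : ℕ → ℝ} (h_nonneg : ∀ j, 0 ≤ h j)
    (hh : h =o[atTop] fun j : ℕ => (2 : ℝ) ^ (-2 * (j : ℤ))) :
    ∀ᶠ j in atTop,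
      SolvesInp (wavelet ν) (strip (h j)) (filteredLine ν w ρ j) (filteredLine ν w ρ j) ∧
      ∀ L, SolvesInp (wavelet ν) (strip (h j)) (filteredLine ν w ρ j) L →
        L =ᵐ[volume] filteredLine ν w ρ j := by
  obtain ⟨C, hC, hCb⟩ := tsum_indicator_enorm_wavelet_le hν
  obtain ⟨D, hD, hDb⟩ := setLIntegral_strip_wavelet_le hν
  filter_upwards [eventually_const_mul_ofReal_le h_nonneg hh (ENNReal.mul_ne_top hC hD)] with j hj
  refine (isParsevalFrame_wavelet hν).solvesInp_self_and_unique (Λ := scaleIndices (bandScales j))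
    (memLp_filteredLine hν hρ hw hw_supp j 2) (analysisL1_filteredLine_ne_top hν hρ hw hw_supp j)
    (fun lam hl => coeff_filteredLine_eq_zero hν hρ hw hw_supp j hl) fun z hz hzM => ?_
  refine ((isParsevalFrame_wavelet hν).tsum_indicator_enorm_coeff_le (measurableSet_strip _) _
    (hCb j) (fun lam => hDb lam (h j)) hz hzM).trans ?_
  gcongr
  refine le_of_eq_of_le ?_ hj
  ring

end MeyerInpainting

end

open MeyerInpainting in
theorem mainTheorem3 (ν : ℝ → ℝ) (hν : IsMeyerAux ν)
    (ρ : ℝ) (hρ : 0 < ρ)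
    (w : ℝ → ℝ) (hw_smooth : ContDiff ℝ ∞ w) (hw_range : ∀ t, w t ∈ Set.Icc (0 : ℝ) 1)
    (hw_supp : Function.support w ⊆ Set.Icc (-ρ) ρ) (hw_ne : w ≠ 0)
    (h : ℕ → ℝ) (h_nonneg : ∀ j, 0 ≤ h j)
    (hh : h =o[atTop] fun j : ℕ => (2 : ℝ) ^ (-2 * (j : ℤ))) :
    (∀ j, MemLp (filteredLine ν w ρ j) 2 volume) ∧
    (∀ᶠ j in atTop, eLpNorm (filteredLine ν w ρ j) 2 volume ≠ 0) ∧
    (∀ᶠ j in atTop, ∃ L : Plane → ℂ,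
      SolvesInp (wavelet ν) (strip (h j)) (filteredLine ν w ρ j) L) ∧
    ∀ L : ℕ → Plane → ℂ,
      (∀ᶠ j in atTop,
        SolvesInp (wavelet ν) (strip (h j)) (filteredLine ν w ρ j) (L j)) →
      Tendsto (fun j => eLpNorm (L j - filteredLine ν w ρ j) 2 volume /
        eLpNorm (filteredLine ν w ρ j) 2 volume) atTop (𝓝 0) := by
  have hrec := eventually_exact_recovery hν hρ hw_smooth hw_supp h_nonneg hh
  refine ⟨fun j => memLp_filteredLine hν hρ hw_smooth hw_supp j 2,
    eventually_eLpNorm_filteredLine_ne_zero hν hρ hw_smooth hw_supp hw_ne,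
    hrec.mono fun j hj => ⟨_, hj.1⟩, fun L hL => ?_⟩
  -- The quotient is eventually equal to zero, not merely small.
  refine tendsto_const_nhds.congr' ?_
  filter_upwards [hrec, hL] with j hj hLj
  have : L j - filteredLine ν w ρ j =ᵐ[volume] 0 := by
    filter_upwards [hj.2 _ hLj] with x hx
    simp [hx]
  rw [eLpNorm_congr_ae this, eLpNorm_zero, ENNReal.zero_div]
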